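/- All categories and 2-categories are small (relative to a fixed universe) and 2-categories are strict; $\mathbf{Cat}$ denotes the category of small categories and functors, $2\text{-}\mathbf{Cat}$ the category of small 2-categories and strict 2-functors, and $e$ the terminal (2-)category. A class $S$ of morphisms of a category is \emph{weakly saturated} if it contains the identities, has the two-out-of-three property, and if, for all $i:X\to Y$ and $r:Y\to X$ with $ri=1_X$ and $ir\in S$, one has $r\in S$. A \emph{basic localizer of $\mathbf{Cat}$} is a weakly saturated class $W$ of functors between small categories such that (LB) $A\to e$ is in $W$ whenever $A$ has a terminal object; (LC) for every commutative triangle $w=vu$ with $u:A\to B$, $v:B\to C$ in $\mathbf{Cat}$, if the induced functor $u/c:A/c\to B/c$ is in $W$ for every object $c$ of $C$, then $u$ is in $W$. For a strict 2-functor $u:\mathcal A\to\mathcal B$ and an object $b$ of $\mathcal B$, the \emph{colax slice} $\mathcal A/\!/^{\mathrm{c}}_{u}\,b$ is the 2-category whose objects are the pairs $(a,p:u(a)\to b)$, whose 1-cells $(a,p)\to(a',p')$ are the pairs $(f:a\to a',\ \alpha:p'u(f)\Rightarrow p)$, and whose 2-cells $(f,\alpha)\Rightarrow(f',\alpha')$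 are the 2-cells $\beta:f\Rightarrow f'$ of $\mathcal A$ such that $\alpha'\,(p'\ast u(\beta))=\alpha$. A commutative triangle $w=vu$ in $2\text{-}\mathbf{Cat}$, with $u:\mathcal A\to\mathcal B$ and $v:\mathcal B\to\mathcal C$, induces for every object $c$ of $\mathcal C$ a strict 2-functor $u/\!/^{\mathrm{c}}c:\mathcal A/\!/^{\mathrm{c}}_{w}\,c\to\mathcal B/\!/^{\mathrm{c}}_{v}\,c$, $(a,p)\mapsto(u(a),p)$, $(f,\alpha)\mapsto(u(f),\alpha)$, $\beta\mapsto u(\beta)$. A \emph{basic localizer of $2\text{-}\mathbf{Cat}$} is a weakly saturated class $\mathcal W$ of strict 2-functors such that (LF2) $\mathcal A\to e$ is in $\mathcal W$ whenever $\mathcal A$ has an object $z$ such that, for every object $a$ of $\mathcal A$, the category $\mathrm{Hom}_{\mathcal A}(a,z)$ has a terminal object; (LF3) for every commutative triangle $w=vu$ as above in $2\text{-}\mathbf{Cat}$, if $u/\!/^{\mathrm{c}}c$ is in $\mathcal W$ for every object $c$ of $\mathcal C$, then $u$ is in $\mathcal W$. For a 2-category $\mathcal A$, let $N_l\mathcal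 A$ (resp. $N_{l,n}\mathcal A$) be the simplicial set whose $m$-simplices are the lax functors (resp. the normalized lax functors) $[m]\to\mathcal A$. For a simplicial set $X$, let $i_\Delta X=\Delta/X$ be its category of elements: its objects are the pairs $([m],x)$ with $x\in X_m$ and its morphisms $([m],x)\to([n],y)$ are the morphisms $\varphi:[m]\to[n]$ of $\Delta$ with $\varphi^*y=x$. \textbf{Theorem.} Let $W$ be a basic localizer of $\mathbf{Cat}$. Call a strict 2-functor $u$ a \emph{weak equivalence} if the functor $\Delta/N_l(u)$ is in $W$. (1) For every commutative triangle $w=vu$ in $2\text{-}\mathbf{Cat}$, with $u:\mathcal A\to\mathcal B$ and $v:\mathcal B\to\mathcal C$, if $u/\!/^{\mathrm{c}}c:\mathcal A/\!/^{\mathrm{c}}_{w}\,c\to\mathcal B/\!/^{\mathrm{c}}_{v}\,c$ is a weak equivalence for every object $c$ of $\mathcal C$, then $u$ is a weak equivalence. (2) The class $N_{l,n}^{-1}(i_\Delta^{-1}(W))$ of the strict 2-functors $u$ such that $\Delta/N_{l,n}(u)$ is in $W$ is a basic localizer of $2\text{-}\mathbf{Cat}$. -/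

import Mathlib

open CategoryTheory Bicategory

universe u

namespace TwoCatLoc

section ColaxSlice

variable {A : Type u} [Bicategory.{u, u} A] {B : Type u} [Bicategory.{u, u} B]

/-- Objects of the colax slice of `A` over `b` relative to `F`: pairs `(a, p : F a ⟶ b)`. -/
structure ColaxSlice (F : StrictPseudofunctor A B) (b : B) : Type u where
  base : A
  hom : F.obj base ⟶ b

namespace ColaxSlice

variable {F : StrictPseudofunctor A B} {b : B}

/-- 1-cells `(a, p) ⟶ (a', p')`: pairs `(f : a ⟶ a', α : p' ∘ F f ⟹ p)`. Composition is written in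
diagrammatic order. -/
structure Hom (x y : ColaxSlice F b) : Type u where
  base : x.base ⟶ y.base
  cell : F.map base ≫ y.hom ⟶ x.hom

instance categoryStruct : CategoryStruct.{u} (ColaxSlice F b) where
  Hom x y := Hom x y
  id x := ⟨𝟙 x.base, (F.mapId x.base).hom ▷ x.hom ≫ (λ_ x.hom).hom⟩
  comp {_ _ z} f g := ⟨f.base ≫ g.base,
    (F.mapComp f.base g.base).hom ▷ z.hom ≫ (α_ _ _ _).hom ≫ F.map f.base ◁ g.cell ≫ f.cell⟩

/-- 2-cells `(f, α) ⟹ (g, γ)`: 2-cells `β : f ⟹ g` of `A` such that `γ (p' ∘ F β) = α`. -/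
@[ext]
structure Hom₂ {x y : ColaxSlice F b} (f g : x ⟶ y) : Type u where
  base : f.base ⟶ g.base
  w : F.map₂ base ▷ y.hom ≫ g.cell = f.cell

instance homCategory (x y : ColaxSlice F b) : Category.{u} (x ⟶ y) where
  Hom f g := Hom₂ f g
  id f := ⟨𝟙 f.base, by simp⟩
  comp β γ := ⟨β.base ≫ γ.base, by simp [γ.w, β.w]⟩
  id_comp _ := Hom₂.ext (Category.id_comp _)
  comp_id _ := Hom₂.ext (Category.comp_id _)
  assoc _ _ _ := Hom₂.ext (Category.assoc _ _ _)

@[ext]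
theorem hom₂_ext {x y : ColaxSlice F b} {f g : x ⟶ y} {β γ : f ⟶ g}
    (h : β.base = γ.base) : β = γ := Hom₂.ext h

@[simp] theorem id_base (x : ColaxSlice F b) : (𝟙 x : x ⟶ x).base = 𝟙 x.base := rfl

@[simp] theorem id_cell (x : ColaxSlice F b) :
    (𝟙 x : x ⟶ x).cell = (F.mapId x.base).hom ▷ x.hom ≫ (λ_ x.hom).hom := rfl

@[simp] theorem comp_base {x y z : ColaxSlice F b} (f : x ⟶ y) (g : y ⟶ z) :
    (f ≫ g).base = f.base ≫ g.base := rfl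

@[simp] theorem comp_cell {x y z : ColaxSlice F b} (f : x ⟶ y) (g : y ⟶ z) :
    (f ≫ g).cell = (F.mapComp f.base g.base).hom ▷ z.hom ≫ (α_ _ _ _).hom ≫
      F.map f.base ◁ g.cell ≫ f.cell := rfl

@[simp] theorem id₂_base {x y : ColaxSlice F b} (f : x ⟶ y) :
    (𝟙 f : f ⟶ f).base = 𝟙 f.base := rfl

@[simp] theorem comp₂_base {x y : ColaxSlice F b} {f g h : x ⟶ y} (β : f ⟶ g) (γ : g ⟶ h) :
    (β ≫ γ).base = β.base ≫ γ.base := rfl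

/-- An invertible 2-cell of the slice from an invertible 2-cell of `A`. -/
def isoMk {x y : ColaxSlice F b} {f g : x ⟶ y} (e : f.base ≅ g.base)
    (w : F.map₂ e.hom ▷ y.hom ≫ g.cell = f.cell) : f ≅ g where
  hom := ⟨e.hom, w⟩
  inv := ⟨e.inv, by
    rw [← w, ← Category.assoc, ← comp_whiskerRight, ← PrelaxFunctor.map₂_comp]
    simp⟩
  hom_inv_id := by ext; exact e.hom_inv_id
  inv_hom_id := by ext; exact e.inv_hom_id

theorem whiskerLeft_w {x y z : ColaxSlice F b} (f : x ⟶ y) {g h : y ⟶ z} (β : g ⟶ h) :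
    F.map₂ (f.base ◁ β.base) ▷ z.hom ≫ (f ≫ h).cell = (f ≫ g).cell := by
  simp [← β.w]

theorem whiskerRight_w {x y z : ColaxSlice F b} {f g : x ⟶ y} (β : f ⟶ g) (h : y ⟶ z) :
    F.map₂ (β.base ▷ h.base) ▷ z.hom ≫ (g ≫ h).cell = (f ≫ h).cell := by
  simp [← β.w, whisker_exchange_assoc]

theorem associator_w {w x y z : ColaxSlice F b} (f : w ⟶ x) (g : x ⟶ y) (h : y ⟶ z) :
    F.map₂ (α_ f.base g.base h.base).hom ▷ z.hom ≫ (f ≫ g ≫ h).cell = ((f ≫ g) ≫ h).cell := by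
  simp [whisker_exchange_assoc]

theorem leftUnitor_w {x y : ColaxSlice F b} (f : x ⟶ y) :
    F.map₂ (λ_ f.base).hom ▷ y.hom ≫ f.cell = (𝟙 x ≫ f).cell := by
  simp [whisker_exchange_assoc]

theorem rightUnitor_w {x y : ColaxSlice F b} (f : x ⟶ y) :
    F.map₂ (ρ_ f.base).hom ▷ y.hom ≫ f.cell = (f ≫ 𝟙 y).cell := by
  simp

instance bicategory : Bicategory.{u, u} (ColaxSlice F b) where
  homCategory := homCategory
  whiskerLeft f _ _ β := Hom₂.mk (f.base ◁ β.base) (whiskerLeft_w f β)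
  whiskerRight β h := Hom₂.mk (β.base ▷ h.base) (whiskerRight_w β h)
  associator f g h := isoMk (α_ f.base g.base h.base) (associator_w f g h)
  leftUnitor f := isoMk (λ_ f.base) (leftUnitor_w f)
  rightUnitor f := isoMk (ρ_ f.base) (rightUnitor_w f)
  whiskerLeft_id _ _ := hom₂_ext (Bicategory.whiskerLeft_id _ _)
  whiskerLeft_comp _ _ _ _ _ _ := hom₂_ext (Bicategory.whiskerLeft_comp _ _ _)
  id_whiskerLeft _ := hom₂_ext (Bicategory.id_whiskerLeft _)
  comp_whiskerLeft _ _ _ _ _ := hom₂_ext (Bicategory.comp_whiskerLeft _ _ _)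
  id_whiskerRight _ _ := hom₂_ext (Bicategory.id_whiskerRight _ _)
  comp_whiskerRight _ _ _ := hom₂_ext (Bicategory.comp_whiskerRight _ _ _)
  whiskerRight_id _ := hom₂_ext (Bicategory.whiskerRight_id _)
  whiskerRight_comp _ _ _ := hom₂_ext (Bicategory.whiskerRight_comp _ _ _)
  whisker_assoc _ _ _ _ _ := hom₂_ext (Bicategory.whisker_assoc _ _ _)
  whisker_exchange _ _ := hom₂_ext (Bicategory.whisker_exchange _ _)
  pentagon _ _ _ _ := hom₂_ext (Bicategory.pentagon _ _ _ _)
  triangle _ _ := hom₂_ext (Bicategory.triangle _ _)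

@[simp] theorem whiskerLeft_base {x y z : ColaxSlice F b} (f : x ⟶ y) {g h : y ⟶ z}
    (β : g ⟶ h) : (f ◁ β).base = f.base ◁ β.base := rfl

@[simp] theorem whiskerRight_base {x y z : ColaxSlice F b} {f g : x ⟶ y} (β : f ⟶ g)
    (h : y ⟶ z) : (β ▷ h).base = β.base ▷ h.base := rfl

@[simp] theorem eqToHom_base {x y : ColaxSlice F b} {f g : x ⟶ y} (h : f = g) :
    (eqToHom h).base = eqToHom (congrArg Hom.base h) := by
  subst h; rfl

theorem hom_ext {x y : ColaxSlice F b} {f g : x ⟶ y} (h : f.base = g.base)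
    (w : F.map₂ (eqToHom h) ▷ y.hom ≫ g.cell = f.cell) : f = g := by
  obtain ⟨f, α⟩ := f
  obtain ⟨g, β⟩ := g
  obtain rfl : f = g := h
  simp at w
  rw [w]

theorem hom_ext_of_iso {x y : ColaxSlice F b} {f g : x ⟶ y} (e : f ≅ g) (h : f.base = g.base)
    (w : e.hom.base = eqToHom h) : f = g :=
  hom_ext h (by rw [← w]; exact e.hom.w)

theorem eq_eqToIso {x y : ColaxSlice F b} {f g : x ⟶ y} (e : f ≅ g) (h : f = g)
    (w : e.hom.base = eqToHom (congrArg Hom.base h)) : e = eqToIso h := by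
  ext
  rw [w]
  exact (eqToHom_base h).symm

instance strict [Strict A] : Strict (ColaxSlice F b) where
  id_comp f := hom_ext_of_iso (λ_ f) (Strict.id_comp f.base)
    (congrArg Iso.hom (Strict.leftUnitor_eqToIso f.base))
  comp_id f := hom_ext_of_iso (ρ_ f) (Strict.comp_id f.base)
    (congrArg Iso.hom (Strict.rightUnitor_eqToIso f.base))
  assoc f g h := hom_ext_of_iso (α_ f g h) (Strict.assoc f.base g.base h.base)
    (congrArg Iso.hom (Strict.associator_eqToIso f.base g.base h.base))
  leftUnitor_eqToIso f := eq_eqToIso (λ_ f) _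
    (congrArg Iso.hom (Strict.leftUnitor_eqToIso f.base))
  rightUnitor_eqToIso f := eq_eqToIso (ρ_ f) _
    (congrArg Iso.hom (Strict.rightUnitor_eqToIso f.base))
  associator_eqToIso f g h := eq_eqToIso (α_ f g h) _
    (congrArg Iso.hom (Strict.associator_eqToIso f.base g.base h.base))

end ColaxSlice

variable {C : Type u} [Bicategory.{u, u} C]

theorem map_id_aux (u : StrictPseudofunctor A B) (v : StrictPseudofunctor B C) {a : A} {c : C}
    (p : v.obj (u.obj a) ⟶ c) :
    v.map₂ (eqToHom (u.map_id a)) ▷ p ≫ (v.mapId (u.obj a)).hom ▷ p ≫ (λ_ p).hom =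
      (v.map₂ (u.mapId a).hom ≫ (v.mapId (u.obj a)).hom) ▷ p ≫ (λ_ p).hom := by
  rw [u.mapId_eq_eqToIso, eqToIso.hom, comp_whiskerRight, Category.assoc]

theorem map_comp_aux (u : StrictPseudofunctor A B) (v : StrictPseudofunctor B C)
    {a a' a'' : A} {c : C} (f : a ⟶ a') (g : a' ⟶ a'') {p : v.obj (u.obj a) ⟶ c}
    {p' : v.obj (u.obj a') ⟶ c} {p'' : v.obj (u.obj a'') ⟶ c}
    (α : v.map (u.map f) ≫ p' ⟶ p) (β : v.map (u.map g) ≫ p'' ⟶ p') :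
    v.map₂ (eqToHom (u.map_comp f g)) ▷ p'' ≫ (v.mapComp (u.map f) (u.map g)).hom ▷ p'' ≫
        (α_ _ _ _).hom ≫ v.map (u.map f) ◁ β ≫ α =
      (v.map₂ (u.mapComp f g).hom ≫ (v.mapComp (u.map f) (u.map g)).hom) ▷ p'' ≫
        (α_ _ _ _).hom ≫ v.map (u.map f) ◁ β ≫ α := by
  rw [u.mapComp_eq_eqToIso, eqToIso.hom, comp_whiskerRight, Category.assoc]

variable [Strict A] [Strict B] [Strict C]

/-- The strict 2-functor `u/c` from the colax slice of `A` over `c` relative to `v ∘ u` to the colax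
slice of `B` over `c` relative to `v`: `(a, p) ↦ (u a, p)`, `(f, α) ↦ (u f, α)`, `β ↦ u β`. -/
def ColaxSlice.map (u : StrictPseudofunctor A B) (v : StrictPseudofunctor B C) (c : C) :
    StrictPseudofunctor (ColaxSlice (u.comp v) c) (ColaxSlice v c) :=
  StrictPseudofunctor.mk''
    { obj := fun x => ⟨u.obj x.base, x.hom⟩
      map := fun f => ⟨u.map f.base, f.cell⟩
      map₂ := fun β => ⟨u.map₂ β.base, β.w⟩
      map₂_id := fun _ => ColaxSlice.hom₂_ext (u.map₂_id _)
      map₂_comp := fun _ _ => ColaxSlice.hom₂_ext (u.map₂_comp _ _)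
      map_id := fun x => ColaxSlice.hom_ext (u.map_id x.base) (map_id_aux u v x.hom)
      map_comp := fun f g => ColaxSlice.hom_ext (u.map_comp f.base g.base)
        (map_comp_aux u v f.base g.base f.cell g.cell)
      map₂_whisker_left := fun f _ _ η => ColaxSlice.hom₂_ext (by
        simp only [ColaxSlice.comp₂_base, ColaxSlice.eqToHom_base]
        simp [StrictPseudofunctor.mapComp_eq_eqToIso])
      map₂_whisker_right := fun η f => ColaxSlice.hom₂_ext (by
        simp only [ColaxSlice.comp₂_base, ColaxSlice.eqToHom_base]
        simp [StrictPseudofunctor.mapComp_eq_eqToIso]) }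

end ColaxSlice

/-- Small strict 2-categories. -/
structure TwoCat : Type (u + 1) where
  carrier : Type u
  [bicategory : Bicategory.{u, u} carrier]
  [strict : Strict carrier]

namespace TwoCat

attribute [instance] bicategory strict

instance coeSort : CoeSort TwoCat.{u} (Type u) := ⟨carrier⟩

section
variable {A B : Type u} [Bicategory.{u, u} A] [Bicategory.{u, u} B]

theorem ext_lax {A B : Type*} [Bicategory A] [Bicategory B] {x y : LaxFunctor A B}
    (h : x.toPrelaxFunctor = y.toPrelaxFunctor)
    (h₁ : ∀ a, HEq (x.mapId a) (y.mapId a))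
    (h₂ : ∀ {a b c : A} (f : a ⟶ b) (g : b ⟶ c), HEq (x.mapComp f g) (y.mapComp f g)) : x = y := by
  cases x; cases y
  cases h
  congr
  · ext a; exact eq_of_heq (h₁ a)
  · ext a b c f g; exact eq_of_heq (h₂ f g)

theorem ext_strict {x y : StrictPseudofunctor A B} (h : x.toPrelaxFunctor = y.toPrelaxFunctor) :
    x = y := by
  obtain ⟨⟨⟨x, i, c, _, _, _, _, _⟩, hi, hi'⟩, hc, hc'⟩ := x
  obtain ⟨⟨⟨y, j, d, _, _, _, _, _⟩, hj, hj'⟩, hd, hd'⟩ := y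
  obtain rfl : x = y := h
  obtain rfl : @i = @j := by funext a; exact (hi' a).trans (hj' a).symm
  obtain rfl : @c = @d := by funext _ _ _ f g; exact (hc' f g).trans (hd' f g).symm
  rfl
end

/-- The category of small strict 2-categories and strict 2-functors. -/
instance category : Category TwoCat.{u} where
  Hom A B := StrictPseudofunctor A B
  id A := StrictPseudofunctor.id A
  comp u v := u.comp v
  id_comp _ := ext_strict rfl
  comp_id _ := ext_strict rfl
  assoc _ _ _ := ext_strict rfl

/-- The 2-category with exactly one object, one 1-cell and one 2-cell. -/
def point : TwoCat.{u} := ⟨LocallyDiscrete (Discrete PUnit.{u + 1})⟩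

/-- The canonical strict 2-functor to the point. -/
def toPoint (A : TwoCat.{u}) : A ⟶ point :=
  StrictPseudofunctor.mk'' (B := A) (C := LocallyDiscrete (Discrete PUnit.{u + 1}))
    { obj := fun _ => ⟨⟨PUnit.unit⟩⟩
      map := fun _ => 𝟙 _
      map₂ := fun _ => 𝟙 _
      map_id := fun _ => rfl
      map_comp := fun _ _ => rfl }

/-- The colax slice as an object of the category of small 2-categories. -/
def colaxSlice {A B : TwoCat.{u}} (v : A ⟶ B) (b : B) : TwoCat.{u} :=
  ⟨ColaxSlice v b⟩

/-- The morphism induced on colax slices over `c` by the commutative triangle with sides `u`, `v`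
and `u ≫ v`. -/
def colaxSliceMap {A B C : TwoCat.{u}} (u : A ⟶ B) (v : B ⟶ C) (c : C) :
    colaxSlice (u ≫ v) c ⟶ colaxSlice v c :=
  ColaxSlice.map u v c

section Nerve

open Opposite

/-- The ordered set `[n] = {0, …, n}`, seen as a category and then as a 2-category. -/
abbrev Ord (n : SimplexCategory) : Type := LocallyDiscrete (Fin (n.len + 1))

variable {A : Type u} [Bicategory.{u, u} A] {l m n : SimplexCategory}

/-- Action on objects of a monotone map `[m] → [n]`. -/
abbrev Ord.mapObj (φ : m ⟶ n) (i : Ord m) : Ord n := ⟨φ.toOrderHom i.as⟩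

/-- Action on 1-cells of a monotone map `[m] → [n]`. -/
abbrev Ord.map (φ : m ⟶ n) {i j : Ord m} (f : i ⟶ j) : Ord.mapObj φ i ⟶ Ord.mapObj φ j :=
  ⟨homOfLE (φ.toOrderHom.monotone (leOfHom f.as))⟩

/-- Restriction of a lax functor `[n] → A` along a monotone map `[m] → [n]`. -/
def reindex (φ : m ⟶ n) (x : LaxFunctor (Ord n) A) : LaxFunctor (Ord m) A where
  obj i := x.obj (Ord.mapObj φ i)
  map f := x.map (Ord.map φ f)
  map₂ _ := x.map₂ (eqToHom rfl)
  mapId i := x.mapId (Ord.mapObj φ i)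
  mapComp f g := x.mapComp (Ord.map φ f) (Ord.map φ g)
  map₂_id _ := x.map₂_id _
  map₂_comp _ _ := x.map₂_comp (eqToHom rfl) (eqToHom rfl)
  mapComp_naturality_left {_ _ _ f f'} _ g :=
    x.mapComp_naturality_left (f := Ord.map φ f) (f' := Ord.map φ f') (eqToHom rfl) (Ord.map φ g)
  mapComp_naturality_right f g g' _ :=
    x.mapComp_naturality_right (Ord.map φ f) (g := Ord.map φ g) (g' := Ord.map φ g') (eqToHom rfl)
  map₂_associator f g h := x.map₂_associator (Ord.map φ f) (Ord.map φ g) (Ord.map φ h)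
  map₂_leftUnitor f := x.map₂_leftUnitor (Ord.map φ f)
  map₂_rightUnitor f := x.map₂_rightUnitor (Ord.map φ f)

theorem reindex_id (x : LaxFunctor (Ord n) A) : reindex (𝟙 n) x = x := rfl
theorem reindex_comp (φ : l ⟶ m) (ψ : m ⟶ n) (x : LaxFunctor (Ord n) A) :
    reindex (φ ≫ ψ) x = reindex φ (reindex ψ x) := rfl

/-- Restriction of a normalized lax functor. The unit 2-cells being identities, the unit axioms of a
lax functor into a strict 2-category force the composition 2-cells for `(1, f)` and `(f, 1)` to be
identities, so that a strictly unitary lax functor is a normalized one. -/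
def reindexNormalized (φ : m ⟶ n) (x : StrictlyUnitaryLaxFunctor (Ord n) A) :
    StrictlyUnitaryLaxFunctor (Ord m) A where
  toLaxFunctor := reindex φ x.toLaxFunctor
  map_id i := x.map_id (Ord.mapObj φ i)
  mapId_eq_eqToHom i := x.mapId_eq_eqToHom (Ord.mapObj φ i)

/-- The lax nerve of `A`: its `n`-simplices are the lax functors `[n] → A`. -/
def laxNerveObj (A : TwoCat.{u}) : SSet.{u} where
  obj n := LaxFunctor (Ord n.unop) A
  map φ := ↾fun x => reindex φ.unop x

/-- The normalized lax nerve of `A`: its `n`-simplices are the normalized lax functors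
`[n] → A`. -/
def normalizedLaxNerveObj (A : TwoCat.{u}) : SSet.{u} where
  obj n := StrictlyUnitaryLaxFunctor (Ord n.unop) A
  map φ := ↾fun x => reindexNormalized φ.unop x

/-- A strict 2-functor seen as a normalized lax functor. -/
def toNormalizedLax {A B : TwoCat.{u}} (u : A ⟶ B) : StrictlyUnitaryLaxFunctor A B :=
  StrictlyUnitaryPseudofunctor.toStrictlyUnitaryLaxFunctor
    (StrictPseudofunctor.toStrictlyUnitaryPseudofunctor u)

theorem lax_comp_id {A : TwoCat.{u}} (x : LaxFunctor (Ord n) A) :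
    LaxFunctor.comp x (toNormalizedLax (𝟙 A)).toLaxFunctor = x :=
  ext_lax (x := LaxFunctor.comp x (toNormalizedLax (𝟙 A)).toLaxFunctor) rfl
    (fun a => heq_of_eq (Category.id_comp (x.mapId a)))
    (fun f g => heq_of_eq (Category.id_comp (x.mapComp f g)))

theorem map₂_comp_aux {A B : Type u} [Bicategory.{u, u} A] [Bicategory.{u, u} B]
    (v : PrelaxFunctor A B) {a b : A} {f g h : a ⟶ b} {k : v.obj a ⟶ v.obj b}
    (p : k ⟶ v.map f) (q : f ⟶ g) (r : g ⟶ h) :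
    (p ≫ v.map₂ q) ≫ v.map₂ r = p ≫ v.map₂ (q ≫ r) := by simp

theorem lax_comp_comp {A B C : TwoCat.{u}} (x : LaxFunctor (Ord n) A) (u : A ⟶ B) (v : B ⟶ C) :
    LaxFunctor.comp x (toNormalizedLax (u ≫ v)).toLaxFunctor =
      LaxFunctor.comp (LaxFunctor.comp x (toNormalizedLax u).toLaxFunctor)
        (toNormalizedLax v).toLaxFunctor :=
  ext_lax (x := LaxFunctor.comp x (toNormalizedLax (u ≫ v)).toLaxFunctor)
    (y := LaxFunctor.comp (LaxFunctor.comp x (toNormalizedLax u).toLaxFunctor)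
        (toNormalizedLax v).toLaxFunctor) rfl
    (fun a => heq_of_eq (map₂_comp_aux (toNormalizedLax v).toPrelaxFunctor
      ((toNormalizedLax v).mapId _) ((toNormalizedLax u).mapId (x.obj a))
      ((toNormalizedLax u).map₂ (x.mapId a))))
    (fun f g => heq_of_eq (map₂_comp_aux (toNormalizedLax v).toPrelaxFunctor
      ((toNormalizedLax v).mapComp _ _) ((toNormalizedLax u).mapComp (x.map f) (x.map g))
      ((toNormalizedLax u).map₂ (x.mapComp f g))))

/-- The lax nerve, on the category of 2-categories and strict 2-functors. -/
def laxNerve : TwoCat.{u} ⥤ SSet.{u} where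
  obj := laxNerveObj
  map u := { app n := ↾fun x => LaxFunctor.comp x (toNormalizedLax u).toLaxFunctor }
  map_id A := by
    ext n x
    exact lax_comp_id x
  map_comp u v := by
    ext n x
    exact lax_comp_comp x u v

theorem normalized_ext {A B : Type*} [Bicategory A] [Bicategory B]
    {x y : StrictlyUnitaryLaxFunctor A B}
    (h : x.toLaxFunctor = y.toLaxFunctor) : x = y := by
  cases x; cases y; cases h; rfl

/-- The normalized lax nerve. -/
def normalizedLaxNerve : TwoCat.{u} ⥤ SSet.{u} where
  obj := normalizedLaxNerveObj
  map u := { app n := ↾fun x => StrictlyUnitaryLaxFunctor.comp x (toNormalizedLax u) }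
  map_id A := by
    ext n x
    exact normalized_ext (lax_comp_id (StrictlyUnitaryLaxFunctor.toLaxFunctor x))
  map_comp u v := by
    ext n x
    exact normalized_ext (lax_comp_comp (StrictlyUnitaryLaxFunctor.toLaxFunctor x) u v)

/-- The functor `X ↦ Δ/X`: objects are pairs `([n], x)` with `x` an `n`-simplex of `X`, morphisms
`([m], x) ⟶ ([n], y)` are the monotone maps `φ : [m] → [n]` with `y φ = x`. The sets of morphisms
are lifted to the universe `u`. -/
def simplices : SSet.{u} ⥤ Cat.{u, u} where
  obj X := Cat.of (ULiftHom.{u} (X.Elementsᵒᵖ))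
  map f := (ULiftHom.down ⋙ (CategoryOfElements.map f).op ⋙ ULiftHom.up).toCatHom

end Nerve

end TwoCat

/-- Weak saturation: identities, two out of three, and, for `i : X ⟶ Y`, `r : Y ⟶ X` with
`r ∘ i = 1`, if `i ∘ r` is in the class then so is `r`. -/
structure IsWeaklySaturated {C : Type*} [Category C] (W : MorphismProperty C) : Prop where
  id_mem (X : C) : W (𝟙 X)
  comp_mem {X Y Z : C} (f : X ⟶ Y) (g : Y ⟶ Z) : W f → W g → W (f ≫ g)
  of_comp_left {X Y Z : C} (f : X ⟶ Y) (g : Y ⟶ Z) : W f → W (f ≫ g) → W g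
  of_comp_right {X Y Z : C} (f : X ⟶ Y) (g : Y ⟶ Z) : W g → W (f ≫ g) → W f
  retraction_mem {X Y : C} (i : X ⟶ Y) (r : Y ⟶ X) : i ≫ r = 𝟙 X → W (r ≫ i) → W r

/-- Basic localizers of the category of small categories. A commutative triangle over `C` is given
by `u : A ⟶ B` and `v : B ⟶ C`, its third side being `u ≫ v`; the functor `u/c : A/c ⥤ B/c` is
`CostructuredArrow.pre`. -/
structure IsBasicLocalizer (W : MorphismProperty Cat.{u, u}) : Prop where
  weaklySaturated : IsWeaklySaturated W
  terminal_mem (A : Cat.{u, u}) [Limits.HasTerminal A] :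
    W (X := A) (Y := Cat.of (Discrete PUnit.{u + 1})) (Functor.star A).toCatHom
  slice_mem {A B C : Cat.{u, u}} (u : A ⟶ B) (v : B ⟶ C) :
    (∀ c : C, W (CostructuredArrow.pre u.toFunctor v.toFunctor c).toCatHom) → W u

namespace TwoCat

/-- The object `z` of the 2-category `A` "admits a terminal object": each category of 1-cells
from some `a` to `z` has a terminal object. -/
def AdmitsTerminal {A : TwoCat.{u}} (z : A) : Prop :=
  ∀ a : A, Limits.HasTerminal (a ⟶ z)

/-- Basic localizers of the category of small strict 2-categories and strict 2-functors. A
commutative triangle over `C` is given by `u` and `v`, its third side being `u ≫ v`. -/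
structure IsBasicLocalizer (W : MorphismProperty TwoCat.{u}) : Prop where
  weaklySaturated : IsWeaklySaturated W
  terminal_mem (A : TwoCat.{u}) : (∃ z : A, AdmitsTerminal z) → W (toPoint A)
  slice_mem {A B C : TwoCat.{u}} (u : A ⟶ B) (v : B ⟶ C) :
    (∀ c : C, W (colaxSliceMap u v c)) → W u

/-- The class of strict 2-functors whose image under `Δ/N_l` is in `W`. -/
def laxClass (W : MorphismProperty Cat.{u, u}) : MorphismProperty TwoCat.{u} :=
  W.inverseImage (laxNerve ⋙ simplices)

/-- The class of strict 2-functors whose image under `Δ/N_{l,n}` is in `W`. -/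
def normalizedLaxClass (W : MorphismProperty Cat.{u, u}) : MorphismProperty TwoCat.{u} :=
  W.inverseImage (normalizedLaxNerve ⋙ simplices)

end TwoCat

end TwoCatLoc

namespace TwoCatLoc

open Opposite

/-! Everything is reduced to a statement about simplicial sets over the lax nerve of `C`. A lax
functor from `[m]` to the colax slice over `c` is the same thing as a lax functor `x : [m] → A`
together with a lax cone from its image in `C` to `c` (`sliceIso`, `normalizedSliceIso`). Hence both
(1) and (LF3) follow from one claim: if `α : X ⟶ Y` is a map of simplicial sets over the lax nerve
of `C`, and for every object `c` the map it induces on simplices equipped with a cone to `c` is in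
`W`, then `α` is in `W` (`mem_map_of_coneOverMap`). The lax and the normalized nerve are both
allowed as `X` and `Y`, which is why the two parts are proved together.

The claim is a bisimplicial form of Quillen's Theorem A. Take the bisimplicial set of lax cones from
an arbitrary `m`-simplex `s` to a normalized `n`-simplex `z` of `C`, that is, lax functors on the
join `[m] * [n]` normalized on `[n]`. Pulled back to `X`, it yields a category `Total` that projects
to the elements of `X` and to those of the normalized nerve of `C`.

The coslices of the first projection are, up to `W`, the simplicial sets of cones with fixed source
`s`. These have an extra degeneracy, because the last vertex of `s` can be inserted in front of the
target; so the first projection is in `W` (`mem_toDom`). The coslices of the second projection are,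
up to `W`, the simplices of `X` equipped with a cone to a fixed `z`; they deformation retract onto
the simplices equipped with a cone to the initial vertex of `z` (`mem_sliceRestrict`), where the
hypothesis applies. The axiom (LC), in its dual form for coslices, puts the map between total
categories in `W`, and two out of three gives `α`.

The dual of (LC) holds because `W` is stable under passage to opposite categories, as twisted arrow
categories show (`mem_op_iff`). For (LF2), an object `z` admitting a terminal object can be appended
to every normalized simplex by terminal 1-cells and 2-cells, which is again an extra degeneracy
(`aspherical_nset`). Weak saturation passes to inverse images under any functor. -/

/-- A functor between small categories belongs to the class `W`. -/
abbrev Mem (W : MorphismProperty Cat.{u, u}) {A B : Type u} [Category.{u} A] [Category.{u} B]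
    (F : A ⥤ B) : Prop :=
  W F.toCatHom

/-- A small category is `W`-aspherical if its functor to the point is in `W`. -/
abbrev Aspherical (W : MorphismProperty Cat.{u, u}) (A : Type u) [Category.{u} A] : Prop :=
  Mem W (Functor.star.{u} A)

/-! ### Formal consequences of the axioms: adjoints, homotopies, contractions. -/

namespace IsBasicLocalizer

variable {W : MorphismProperty Cat.{u, u}} (hW : IsBasicLocalizer W)
variable {A B C D : Type u} [Category.{u} A] [Category.{u} B] [Category.{u} C] [Category.{u} D]

include hW

theorem mem_id : Mem W (𝟭 A) := hW.weaklySaturated.id_mem (Cat.of A)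

theorem mem_comp {F : A ⥤ B} {G : B ⥤ C} (hF : Mem W F) (hG : Mem W G) : Mem W (F ⋙ G) :=
  hW.weaklySaturated.comp_mem F.toCatHom G.toCatHom hF hG

theorem mem_of_comp_left {F : A ⥤ B} {G : B ⥤ C} (hF : Mem W F) (h : Mem W (F ⋙ G)) : Mem W G :=
  hW.weaklySaturated.of_comp_left F.toCatHom G.toCatHom hF h

theorem mem_of_comp_right {F : A ⥤ B} {G : B ⥤ C} (hG : Mem W G) (h : Mem W (F ⋙ G)) :
    Mem W F :=
  hW.weaklySaturated.of_comp_right F.toCatHom G.toCatHom hG h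

theorem mem_retraction {I : A ⥤ B} {R : B ⥤ A} (h : I ⋙ R = 𝟭 A) (hR : Mem W (R ⋙ I)) :
    Mem W R :=
  hW.weaklySaturated.retraction_mem I.toCatHom R.toCatHom (Cat.ext h) hR

theorem aspherical_of_hasTerminal [h : Limits.HasTerminal A] : Aspherical W A :=
  @IsBasicLocalizer.terminal_mem W hW (Cat.of A) h

theorem mem_iff_of_aspherical (hA : Aspherical W A) (F : A ⥤ B) : Mem W F ↔ Aspherical W B :=
  ⟨fun h => hW.mem_of_comp_left h (G := Functor.star B) hA,
    fun h => hW.mem_of_comp_right (F := F) h hA⟩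

theorem mem_of_aspherical (hA : Aspherical W A) (hB : Aspherical W B) (F : A ⥤ B) : Mem W F :=
  (hW.mem_iff_of_aspherical hA F).2 hB

theorem aspherical_of_mem {F : A ⥤ B} (hF : Mem W F) (hA : Aspherical W A) : Aspherical W B :=
  (hW.mem_iff_of_aspherical hA F).1 hF

theorem mem_of_costructuredArrow_pre (F : A ⥤ B) (G : B ⥤ C)
    (h : ∀ c : C, Mem W (CostructuredArrow.pre F G c)) : Mem W F :=
  hW.slice_mem F.toCatHom G.toCatHom h

/-- Theorem A: this is (LC) over the identity of `B`, whose slices have a terminal object. -/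
theorem mem_of_aspherical_costructuredArrow (F : A ⥤ B)
    (h : ∀ b : B, Aspherical W (CostructuredArrow F b)) : Mem W F := by
  refine hW.mem_of_costructuredArrow_pre F (𝟭 B) fun b => ?_
  have : Limits.HasTerminal (CostructuredArrow (𝟭 B) b) :=
    (CostructuredArrow.mkIdTerminal (S := 𝟭 B) (Y := b)).hasTerminal
  exact hW.mem_of_aspherical (h b) hW.aspherical_of_hasTerminal _

theorem mem_of_hasTerminal_costructuredArrow (F : A ⥤ B)
    (h : ∀ b : B, Limits.HasTerminal (CostructuredArrow F b)) : Mem W F :=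
  hW.mem_of_aspherical_costructuredArrow F fun b =>
    have := h b
    hW.aspherical_of_hasTerminal

/-- A functor with a universal arrow to every object is in `W`. -/
theorem mem_of_universal (F : A ⥤ B) (R : B → A) (e : ∀ b, F.obj (R b) ⟶ b)
    (lift : ∀ {a b} (_ : F.obj a ⟶ b), a ⟶ R b)
    (fac : ∀ {a b} (f : F.obj a ⟶ b), F.map (lift f) ≫ e b = f)
    (uniq : ∀ {a b} (f g : a ⟶ R b), F.map f ≫ e b = F.map g ≫ e b → f = g) : Mem W F := by
  refine hW.mem_of_hasTerminal_costructuredArrow F fun b => ?_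
  refine (Limits.IsTerminal.ofUniqueHom (Y := CostructuredArrow.mk (e b))
    (fun X => CostructuredArrow.homMk (lift X.hom) (fac X.hom)) fun X m => ?_).hasTerminal
  ext
  refine uniq _ _ ?_
  exact (CostructuredArrow.w m).trans (fac X.hom).symm

theorem mem_of_equivalence (F : A ⥤ B) [F.IsEquivalence] : Mem W F :=
  hW.mem_of_universal F F.inv.obj (fun b => F.asEquivalence.counit.app b)
    (fun f => (F.asEquivalence.toAdjunction.homEquiv _ _) f)
    (fun f => (F.asEquivalence.toAdjunction.homEquiv _ _).symm_apply_apply f)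
    (fun _ _ h => (F.asEquivalence.toAdjunction.homEquiv _ _).symm.injective h)

/-- The codomain functor is left adjoint to `b ↦ 𝟙 b`. -/
theorem mem_arrow_rightFunc : Mem W (Arrow.rightFunc : Arrow B ⥤ B) :=
  hW.mem_of_universal Arrow.rightFunc (fun b => Arrow.mk (𝟙 b)) (fun b => 𝟙 b)
    (fun {a b} f => Arrow.homMk (u := a.hom ≫ f) (v := f) (by simp))
    (fun f => Category.comp_id f)
    (fun f g h => by
      have h' : f.right = g.right :=
        (Category.comp_id f.right).symm.trans (h.trans (Category.comp_id g.right))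
      have hf := f.w
      have hg := g.w
      ext
      · simp at hf hg
        rw [hf, hg, h']
      · exact h')

/-- The domain and codomain functors share the section `b ↦ 𝟙 b`, so two out of three carries the
result from one to the other. -/
theorem mem_arrow_leftFunc : Mem W (Arrow.leftFunc : Arrow B ⥤ B) := by
  let diag : B ⥤ Arrow B :=
    { obj := fun b => Arrow.mk (𝟙 b)
      map := fun f => Arrow.homMk (u := f) (v := f) (by simp) }
  have h : Mem W diag :=
    hW.mem_of_comp_right (G := Arrow.rightFunc) hW.mem_arrow_rightFunc hW.mem_id
  exact hW.mem_of_comp_left (F := diag) h hW.mem_id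

/-- A natural transformation is a functor to `Arrow B` whose composites with the two projections,
both in `W`, are `F` and `G`. -/
theorem mem_iff_of_natTrans {F G : A ⥤ B} (α : F ⟶ G) : Mem W F ↔ Mem W G := by
  let H : A ⥤ Arrow B :=
    { obj := fun a => Arrow.mk (α.app a)
      map := fun f => Arrow.homMk (u := F.map f) (v := G.map f) (by simp) }
  have h₁ : Mem W F ↔ Mem W H :=
    ⟨fun h => hW.mem_of_comp_right (G := Arrow.leftFunc) hW.mem_arrow_leftFunc h,
      fun h => hW.mem_comp h hW.mem_arrow_leftFunc⟩
  have h₂ : Mem W G ↔ Mem W H :=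
    ⟨fun h => hW.mem_of_comp_right (G := Arrow.rightFunc) hW.mem_arrow_rightFunc h,
      fun h => hW.mem_comp h hW.mem_arrow_rightFunc⟩
  rw [h₁, h₂]

/-- A category contracting onto an object through a zigzag of three natural transformations is
aspherical. -/
theorem aspherical_of_zigzag (a : A) {F G : A ⥤ A} (α : F ⟶ 𝟭 A) (β : F ⟶ G)
    (γ : (Functor.const A).obj a ⟶ G) : Aspherical W A := by
  -- The zigzag joins the constant endofunctor to the identity. Since the constant functor factors
  -- through the point, the retraction axiom applies to `A → e`.
  have h : Mem W ((Functor.const A).obj a) := by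
    rw [hW.mem_iff_of_natTrans γ, ← hW.mem_iff_of_natTrans β, hW.mem_iff_of_natTrans α]
    exact hW.mem_id
  exact hW.mem_retraction (I := (Functor.const (Discrete PUnit)).obj a) rfl h

/-- If a square commutes and its horizontal sides are in `W`, its vertical sides are in `W`
simultaneously. -/
theorem mem_iff_of_square {F : A ⥤ B} {G : C ⥤ D} {H : A ⥤ C} {K : B ⥤ D} (hH : Mem W H)
    (hK : Mem W K) (e : F ⋙ K ⟶ H ⋙ G) : Mem W F ↔ Mem W G :=
  ⟨fun h => hW.mem_of_comp_left hH ((hW.mem_iff_of_natTrans e).1 (hW.mem_comp h hK)),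
    fun h => hW.mem_of_comp_right hK ((hW.mem_iff_of_natTrans e).2 (hW.mem_comp hH h))⟩

end IsBasicLocalizer

/-! ### Stability under opposites, through twisted arrows. -/

/-- The twisted arrow category: the objects are the arrows of `A`, and a morphism from `f` to `g`
is a factorization of `g` through `f`. -/
structure TwistedArrow (A : Type u) [Category.{u} A] : Type u where
  {src tgt : A}
  arr : src ⟶ tgt

namespace TwistedArrow

variable {A B : Type u} [Category.{u} A] [Category.{u} B]

@[ext]
structure Hom (f g : TwistedArrow A) : Type u where
  src : g.src ⟶ f.src
  tgt : f.tgt ⟶ g.tgt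
  w : src ≫ f.arr ≫ tgt = g.arr := by cat_disch

attribute [simp] Hom.w

@[simp]
theorem Hom.w_assoc {f g : TwistedArrow A} (p : Hom f g) {a : A} (h : g.tgt ⟶ a) :
    p.src ≫ f.arr ≫ p.tgt ≫ h = g.arr ≫ h := by
  rw [← p.w, Category.assoc, Category.assoc]

@[simps]
instance : Category.{u} (TwistedArrow A) where
  Hom f g := Hom f g
  id f := { src := 𝟙 _, tgt := 𝟙 _ }
  comp p q := { src := q.src ≫ p.src, tgt := p.tgt ≫ q.tgt }

@[ext]
theorem hom_ext {f g : TwistedArrow A} {p q : f ⟶ g} (h : p.src = q.src) (h' : p.tgt = q.tgt) :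
    p = q :=
  Hom.ext h h'

/-- The functor sending an arrow to its target. -/
@[simps]
def tgtFunctor (A : Type u) [Category.{u} A] : TwistedArrow A ⥤ A where
  obj f := f.tgt
  map p := p.tgt

/-- The functor sending an arrow to its source. -/
@[simps]
def srcFunctor (A : Type u) [Category.{u} A] : TwistedArrow A ⥤ Aᵒᵖ where
  obj f := op f.src
  map p := p.src.op

/-- The functor induced on twisted arrows. -/
@[simps]
def map (F : A ⥤ B) : TwistedArrow A ⥤ TwistedArrow B where
  obj f := ⟨F.map f.arr⟩
  map p := { src := F.map p.src, tgt := F.map p.tgt, w := by simp [← Functor.map_comp] }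

theorem tgt_aux {x y x' y' a : A} {s : x' ⟶ x} {f : x ⟶ y} {t : y ⟶ y'} {f' : x' ⟶ y'}
    (h : s ≫ f ≫ t = f') {g : y ⟶ a} {g' : y' ⟶ a} (h' : t ≫ g' = g) :
    s ≫ (f ≫ g) ≫ 𝟙 a = f' ≫ g' := by
  simp [← h, ← h']

theorem src_aux {x y x' y' a : A} {s : x' ⟶ x} {f : x ⟶ y} {t : y ⟶ y'} {f' : x' ⟶ y'}
    (h : s ≫ f ≫ t = f') {g : a ⟶ x} {g' : a ⟶ x'} (h' : g' ≫ s = g) :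
    𝟙 a ≫ (g ≫ f) ≫ t = g' ≫ f' := by
  simp [← h, ← h']

end TwistedArrow

namespace IsBasicLocalizer

variable {W : MorphismProperty Cat.{u, u}} (hW : IsBasicLocalizer W)
variable {A B C D : Type u} [Category.{u} A] [Category.{u} B] [Category.{u} C] [Category.{u} D]

include hW

/-- An object of the slice over `a` is a composable pair `f : x ⟶ y`, `g : y ⟶ a`. It maps to the
pair `(f ≫ g, 𝟙 a)`, which also receives a map from `(𝟙 a, 𝟙 a)`; both maps are natural, so the
slice contracts. -/
theorem mem_twistedArrow_tgt : Mem W (TwistedArrow.tgtFunctor A) := by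
  refine hW.mem_of_aspherical_costructuredArrow _ fun a => ?_
  exact hW.aspherical_of_zigzag
    (F := 𝟭 _)
    (G := { obj := fun X => CostructuredArrow.mk (Y := (⟨X.left.arr ≫ X.hom⟩ : TwistedArrow A)) (𝟙 a)
            map := fun {X Y} p => CostructuredArrow.homMk
              { src := p.left.src, tgt := 𝟙 a
                w := TwistedArrow.tgt_aux p.left.w (CostructuredArrow.w p) }
              (Category.id_comp (𝟙 a))
            map_id := fun X => CostructuredArrow.hom_ext _ _ (TwistedArrow.hom_ext rfl rfl)
            map_comp := fun p q => CostructuredArrow.hom_ext _ _ (TwistedArrow.hom_ext rfl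
              (Category.id_comp (𝟙 a)).symm) })
    (CostructuredArrow.mk (Y := (⟨𝟙 a⟩ : TwistedArrow A)) (𝟙 a)) (𝟙 _)
    { app := fun X => CostructuredArrow.homMk
        { src := 𝟙 _, tgt := X.hom, w := Category.id_comp (X.left.arr ≫ X.hom) }
        (Category.comp_id (X := X.left.tgt) X.hom)
      naturality := fun X Y p => CostructuredArrow.hom_ext _ _ (TwistedArrow.hom_ext
        ((Category.id_comp p.left.src).trans (Category.comp_id p.left.src).symm)
        ((CostructuredArrow.w p).trans (Category.comp_id (X := X.left.tgt) X.hom).symm)) }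
    { app := fun X => CostructuredArrow.homMk
        { src := X.left.arr ≫ X.hom, tgt := 𝟙 a
          w := (congrArg (_ ≫ ·) (Category.id_comp (𝟙 a))).trans
            (Category.comp_id (X.left.arr ≫ X.hom)) } (Category.id_comp (𝟙 a))
      naturality := fun X Y p => CostructuredArrow.hom_ext _ _ (TwistedArrow.hom_ext
        ((Category.comp_id (Y.left.arr ≫ Y.hom)).trans
          ((TwistedArrow.tgt_aux p.left.w (CostructuredArrow.w p)).symm.trans
            (congrArg (p.left.src ≫ ·) (Category.comp_id (X.left.arr ≫ X.hom)))))
        rfl) }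

theorem mem_twistedArrow_src : Mem W (TwistedArrow.srcFunctor A) := by
  refine hW.mem_of_aspherical_costructuredArrow _ fun a => ?_
  exact hW.aspherical_of_zigzag
    (F := 𝟭 _)
    (G := { obj := fun X => CostructuredArrow.mk
              (Y := (⟨X.hom.unop ≫ X.left.arr⟩ : TwistedArrow A)) (𝟙 (op a.unop))
            map := fun {X Y} p => CostructuredArrow.homMk
              { src := 𝟙 a.unop, tgt := p.left.tgt
                w := TwistedArrow.src_aux p.left.w
                  (congrArg Quiver.Hom.unop (CostructuredArrow.w p)) }
              (Category.id_comp (𝟙 (op a.unop)))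
            map_id := fun X => CostructuredArrow.hom_ext _ _ (TwistedArrow.hom_ext rfl rfl)
            map_comp := fun p q => CostructuredArrow.hom_ext _ _ (TwistedArrow.hom_ext
              (Category.id_comp (𝟙 a.unop)).symm rfl) })
    (CostructuredArrow.mk (Y := (⟨𝟙 a.unop⟩ : TwistedArrow A)) (𝟙 (op a.unop))) (𝟙 _)
    { app := fun X => CostructuredArrow.homMk
        { src := X.hom.unop, tgt := 𝟙 _
          w := congrArg (X.hom.unop ≫ ·) (Category.comp_id X.left.arr) }
        (Category.comp_id (X := op X.left.src) X.hom)
      naturality := fun X Y p => CostructuredArrow.hom_ext _ _ (TwistedArrow.hom_ext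
        ((congrArg Quiver.Hom.unop (CostructuredArrow.w p)).trans
          (Category.id_comp (Y := X.left.src) X.hom.unop).symm)
        ((Category.comp_id p.left.tgt).trans (Category.id_comp p.left.tgt).symm)) }
    { app := fun X => CostructuredArrow.homMk
        { src := 𝟙 a.unop, tgt := X.hom.unop ≫ X.left.arr
          w := (Category.id_comp _).trans (Category.id_comp (X.hom.unop ≫ X.left.arr)) }
        (Category.id_comp (𝟙 (op a.unop)))
      naturality := fun X Y p => CostructuredArrow.hom_ext _ _ (TwistedArrow.hom_ext rfl
        ((Category.id_comp (Y.hom.unop ≫ Y.left.arr)).trans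
          ((TwistedArrow.src_aux p.left.w
              (congrArg Quiver.Hom.unop (CostructuredArrow.w p))).symm.trans
            ((Category.id_comp _).trans rfl)))) }

/-- `TwistedArrow A` projects to `A` and to `Aᵒᵖ` by functors in `W`, naturally in `A`, so `F` and
`F.op` are both compared with `TwistedArrow.map F`. -/
theorem mem_op_iff (F : A ⥤ B) : Mem W F.op ↔ Mem W F :=
  (hW.mem_iff_of_square (F := TwistedArrow.map F) (G := F.op) hW.mem_twistedArrow_src hW.mem_twistedArrow_src
    (𝟙 (TwistedArrow.map F ⋙ TwistedArrow.srcFunctor B))).symm.trans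
  (hW.mem_iff_of_square (F := TwistedArrow.map F) hW.mem_twistedArrow_tgt hW.mem_twistedArrow_tgt
    (𝟙 (TwistedArrow.map F ⋙ TwistedArrow.tgtFunctor B)))

/-- The dual of (LC): coslices are the opposites of slices of the opposite functors. -/
theorem mem_of_structuredArrow_pre (F : A ⥤ B) (G : B ⥤ C)
    (h : ∀ c : C, Mem W (StructuredArrow.pre c F G)) : Mem W F := by
  rw [← hW.mem_op_iff]
  refine hW.mem_of_costructuredArrow_pre F.op G.op fun c => ?_
  have := (structuredArrowOpEquivalence (F ⋙ G) c.unop).isEquivalence_functor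
  have := (structuredArrowOpEquivalence G c.unop).isEquivalence_functor
  refine (hW.mem_iff_of_square
    (F := (StructuredArrow.pre c.unop F G).op)
    (G := CostructuredArrow.pre F.op G.op c)
    (hW.mem_of_equivalence (structuredArrowOpEquivalence (F ⋙ G) c.unop).functor)
    (hW.mem_of_equivalence (structuredArrowOpEquivalence G c.unop).functor)
    { app := fun X => CostructuredArrow.homMk (𝟙 (op (F.obj X.unop.right)))
        ((congrArg (· ≫ _) (G.op.map_id _)).trans (Category.id_comp _))
      naturality := fun X Y f => CostructuredArrow.hom_ext _ _
        ((Category.comp_id _).trans (Category.id_comp _).symm) }).1 ?_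
  rw [hW.mem_op_iff]
  exact h c.unop

theorem mem_of_aspherical_structuredArrow (F : A ⥤ B)
    (h : ∀ b : B, Aspherical W (StructuredArrow b F)) : Mem W F := by
  refine hW.mem_of_structuredArrow_pre F (𝟭 B) fun b => ?_
  refine hW.mem_of_aspherical (h b) ?_ _
  -- The coslice under `b` has the initial object `𝟙 b`, and the maps out of it form a contraction.
  refine hW.aspherical_of_zigzag (StructuredArrow.mk (𝟙 b)) (𝟙 (𝟭 _)) (𝟙 (𝟭 _))
    { app := fun X => StructuredArrow.homMk X.hom
      naturality := fun X Y f => StructuredArrow.hom_ext _ _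
        ((Category.id_comp _).trans (StructuredArrow.w f).symm) }

end IsBasicLocalizer

/-! ### Categories of elements of simplicial sets. -/

/-- The category of elements of a simplicial set. -/
structure El (X : SSet.{u}) : Type u where
  base : SimplexCategory
  el : X.obj (op base)

namespace El

variable {X Y Z : SSet.{u}}

@[ext]
structure Hom (x y : El X) : Type u where
  base : x.base ⟶ y.base
  w : X.map base.op y.el = x.el

instance : Category.{u} (El X) where
  Hom x y := Hom x y
  id x := ⟨𝟙 x.base, by simp⟩
  comp f g := ⟨f.base ≫ g.base, by simp [f.w, g.w]⟩
  id_comp f := Hom.ext (Category.id_comp f.base)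
  comp_id f := Hom.ext (Category.comp_id f.base)
  assoc f g h := Hom.ext (Category.assoc f.base g.base h.base)

/-- Constructor for morphisms, with expanded objects. -/
def homMk {m n : SimplexCategory} {x : X.obj (op m)} {y : X.obj (op n)} (φ : m ⟶ n)
    (w : X.map φ.op y = x) : (⟨m, x⟩ : El X) ⟶ ⟨n, y⟩ :=
  ⟨φ, w⟩

theorem hom_ext {x y : El X} {f g : x ⟶ y} (h : f.base = g.base) : f = g := Hom.ext h

/-- The functor induced on categories of elements by a morphism of simplicial sets. -/
def map (α : X ⟶ Y) : El X ⥤ El Y where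
  obj x := ⟨x.base, α.app _ x.el⟩
  map {x y} f := ⟨f.base, by rw [← f.w, NatTrans.naturality_apply]⟩

/-- The comparison with the opposite of the category of elements of a functor to types. -/
def toSimplices (X : SSet.{u}) : El X ⥤ ULiftHom.{u} (X.Elementsᵒᵖ) where
  obj x := ULiftHom.objUp (op ⟨op x.base, x.el⟩)
  map {x y} f := ULift.up (Quiver.Hom.op (CategoryOfElements.homMk (F := X)
    ⟨op y.base, y.el⟩ ⟨op x.base, x.el⟩ f.base.op f.w))

end El

theorem IsBasicLocalizer.mem_toSimplices {W : MorphismProperty Cat.{u, u}}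
    (hW : IsBasicLocalizer W) (X : SSet.{u}) : Mem W (El.toSimplices X) :=
  hW.mem_of_universal _ (fun b => ⟨b.objDown.unop.1.unop, b.objDown.unop.2⟩) (fun b => 𝟙 b)
    (fun f => ⟨f.down.unop.1.unop, f.down.unop.2⟩)
    (fun f => Category.comp_id f)
    (fun {a b} f g h => El.hom_ext (congrArg
      (fun k : (El.toSimplices X).obj a ⟶ b => (ULift.down k).unop.val.unop)
      ((Category.comp_id ((El.toSimplices X).map f)).symm.trans
        (h.trans (Category.comp_id ((El.toSimplices X).map g))))))

theorem IsBasicLocalizer.simplices_map_iff {W : MorphismProperty Cat.{u, u}}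
    (hW : IsBasicLocalizer W) {X Y : SSet.{u}} (α : X ⟶ Y) :
    W (TwoCat.simplices.map α) ↔ Mem W (El.map α) :=
  (hW.mem_iff_of_square (F := El.map α) (G := (TwoCat.simplices.map α).toFunctor)
    (hW.mem_toSimplices X) (hW.mem_toSimplices Y)
    (𝟙 (El.map α ⋙ El.toSimplices Y))).symm

/-! ### Ordinals with an added vertex, and extra degeneracies. -/

/-- Extension of a monotone map to a new least element. -/
def consHom {P : Type*} [Preorder P] {n : ℕ} (p : P) (g : Fin (n + 1) →o P) (h : ∀ i, p ≤ g i) :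
    Fin (n + 1 + 1) →o P where
  toFun := Fin.cases p g
  monotone' := by
    intro i j hij
    induction i using Fin.cases with
    | zero =>
      induction j using Fin.cases with
      | zero => exact le_rfl
      | succ j => exact h j
    | succ i =>
      induction j using Fin.cases with
      | zero => exact absurd hij (by simp)
      | succ j => exact g.monotone (by simpa using hij)

/-- Extension of a monotone map to a new greatest element. -/
def snocHom {P : Type*} [Preorder P] {n : ℕ} (g : Fin (n + 1) →o P) (p : P) (h : ∀ i, g i ≤ p) :
    Fin (n + 1 + 1) →o P where
  toFun := Fin.lastCases p g
  monotone' := by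
    intro i j hij
    induction i using Fin.lastCases with
    | last =>
      induction j using Fin.lastCases with
      | last => exact le_rfl
      | cast j => exact absurd hij (by simp [Fin.le_def]; omega)
    | cast i =>
      induction j using Fin.lastCases with
      | last => simpa using h i
      | cast j => simpa using g.monotone (by simpa using hij)

@[simp] theorem snocHom_last {P : Type*} [Preorder P] {n : ℕ} (p : P) (g : Fin (n + 1) →o P)
    (h : ∀ i, g i ≤ p) : snocHom g p h (Fin.last _) = p :=
  Fin.lastCases_last (motive := fun _ => P)

@[simp] theorem snocHom_castSucc {P : Type*} [Preorder P] {n : ℕ} (p : P) (g : Fin (n + 1) →o P)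
    (h : ∀ i, g i ≤ p) (i : Fin (n + 1)) : snocHom g p h i.castSucc = g i :=
  Fin.lastCases_castSucc (motive := fun _ => P) _

namespace Simp

variable {l m n : SimplexCategory}

/-- The ordinal `[n]` with a new vertex added. -/
abbrev cone (n : SimplexCategory) : SimplexCategory := SimplexCategory.mk (n.len + 1)

/-- The ordinal `[0]`. -/
abbrev pt : SimplexCategory := SimplexCategory.mk 0

/-- `[n] ⟶ [0] * [n]`. -/
def inclR (n : SimplexCategory) : n ⟶ cone n := SimplexCategory.Hom.mk (Fin.succOrderEmb _).toOrderHom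

/-- `[n] ⟶ [n] * [0]`. -/
def inclL (n : SimplexCategory) : n ⟶ cone n :=
  SimplexCategory.Hom.mk (Fin.castSuccOrderEmb).toOrderHom

/-- The least vertex. -/
def bot (n : SimplexCategory) : pt ⟶ cone n := SimplexCategory.Hom.mk ⟨fun _ => 0, fun _ _ _ => le_rfl⟩

/-- The greatest vertex. -/
def top (n : SimplexCategory) : pt ⟶ cone n :=
  SimplexCategory.Hom.mk ⟨fun _ => Fin.last _, fun _ _ _ => le_rfl⟩

/-- The map `[0] * φ`. -/
def mapR (φ : m ⟶ n) : cone m ⟶ cone n :=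
  SimplexCategory.Hom.mk (consHom 0 (φ ≫ inclR n).toOrderHom fun _ => Fin.zero_le _)

/-- The map `φ * [0]`. -/
def mapL (φ : m ⟶ n) : cone m ⟶ cone n :=
  SimplexCategory.Hom.mk (snocHom (φ ≫ inclL n).toOrderHom (Fin.last _) fun _ => Fin.le_last _)

theorem hom_ext_cons {f g : cone m ⟶ n} (h : f.toOrderHom 0 = g.toOrderHom 0)
    (h' : ∀ i : Fin (m.len + 1), f.toOrderHom i.succ = g.toOrderHom i.succ) : f = g := by
  ext i
  induction i using Fin.cases with
  | zero => exact congrArg Fin.val h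
  | succ i => exact congrArg Fin.val (h' i)

theorem hom_ext_snoc {f g : cone m ⟶ n}
    (h : f.toOrderHom (Fin.last _) = g.toOrderHom (Fin.last _))
    (h' : ∀ i : Fin (m.len + 1), f.toOrderHom i.castSucc = g.toOrderHom i.castSucc) : f = g := by
  ext i
  induction i using Fin.lastCases with
  | last => exact congrArg Fin.val h
  | cast i => exact congrArg Fin.val (h' i)

theorem mapR_id : mapR (𝟙 n) = 𝟙 _ := hom_ext_cons rfl fun _ => rfl

theorem mapR_comp (φ : l ⟶ m) (ψ : m ⟶ n) : mapR (φ ≫ ψ) = mapR φ ≫ mapR ψ :=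
  hom_ext_cons rfl fun _ => rfl

theorem inclR_mapR (φ : m ⟶ n) : inclR m ≫ mapR φ = φ ≫ inclR n := rfl

theorem bot_mapR (φ : m ⟶ n) : bot m ≫ mapR φ = bot n := rfl

@[simp] theorem mapL_last (φ : m ⟶ n) :
    (mapL φ).toOrderHom (Fin.last _) = Fin.last _ := snocHom_last _ _ fun _ => Fin.le_last _

@[simp] theorem mapL_castSucc (φ : m ⟶ n) (i : Fin (m.len + 1)) :
    (mapL φ).toOrderHom i.castSucc = (φ.toOrderHom i).castSucc := snocHom_castSucc _ _ (fun _ => Fin.le_last _) _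

theorem mapL_id : mapL (𝟙 n) = 𝟙 _ :=
  hom_ext_snoc (mapL_last _) fun i => mapL_castSucc _ i

theorem mapL_comp (φ : l ⟶ m) (ψ : m ⟶ n) : mapL (φ ≫ ψ) = mapL φ ≫ mapL ψ :=
  hom_ext_snoc
    ((mapL_last _).trans ((congrArg (mapL ψ).toOrderHom (mapL_last φ)).trans (mapL_last ψ)).symm)
    fun i => (mapL_castSucc _ i).trans
      ((congrArg (mapL ψ).toOrderHom (mapL_castSucc φ i)).trans (mapL_castSucc ψ _)).symm

theorem inclL_mapL (φ : m ⟶ n) : inclL m ≫ mapL φ = φ ≫ inclL n := by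
  ext i
  exact congrArg Fin.val (mapL_castSucc φ i)

theorem top_mapL (φ : m ⟶ n) : top m ≫ mapL φ = top n := by
  ext i
  exact congrArg Fin.val (mapL_last φ)

end Simp

open Simp

/-- The product of a simplicial set with the standard `1`-simplex. -/
def cylinder (X : SSet.{u}) : SSet.{u} where
  obj n := X.obj n × (Fin (n.unop.len + 1) →o Bool)
  map φ := ↾fun p => (X.map φ p.1, p.2.comp φ.unop.toOrderHom)
  map_id n := by
    apply ConcreteCategory.hom_ext
    intro p
    exact Prod.ext (X.map_id_apply n p.1) rfl
  map_comp f g := by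
    apply ConcreteCategory.hom_ext
    intro p
    exact Prod.ext (X.map_comp_apply f g p.1) rfl

theorem cylinder_map_eq {X : SSet.{u}} {m n : SimplexCategory} (φ : m ⟶ n) {x : X.obj (op m)}
    {y : X.obj (op n)} {t : Fin (m.len + 1) →o Bool} {s : Fin (n.len + 1) →o Bool}
    (h : X.map φ.op y = x) (h' : s.comp φ.toOrderHom = t) :
    (cylinder X).map φ.op (y, s) = (x, t) :=
  Prod.ext h h'

/-- The projection of the cylinder. -/
def cylinderProj (X : SSet.{u}) : cylinder X ⟶ X where
  app n := ↾fun p => p.1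

/-- The inclusion of an end of the cylinder. -/
def cylinderEnd (X : SSet.{u}) (b : Bool) : X ⟶ cylinder X where
  app n := ↾fun x => (x, OrderHom.const _ b)

namespace IsBasicLocalizer

variable {W : MorphismProperty Cat.{u, u}} (hW : IsBasicLocalizer W) {X Y : SSet.{u}}
include hW

/-- A simplicial set with an extra degeneracy has an aspherical category of elements. -/
theorem aspherical_of_extraDegeneracy (x₀ : X.obj (op pt))
    (D : ∀ {n : SimplexCategory}, X.obj (op n) → X.obj (op (cone n)))
    (hD : ∀ {m n : SimplexCategory} (φ : m ⟶ n) (x : X.obj (op n)),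
      X.map (mapR φ).op (D x) = D (X.map φ.op x))
    (hincl : ∀ {n : SimplexCategory} (x : X.obj (op n)), X.map (inclR n).op (D x) = x)
    (hbot : ∀ {n : SimplexCategory} (x : X.obj (op n)), X.map (bot n).op (D x) = x₀) :
    Aspherical W (El X) :=
  -- Adding a vertex is an endofunctor of the category of elements. The inclusion of the old face
  -- and that of the new vertex give natural maps to it from the identity and from a constant
  -- functor.
  hW.aspherical_of_zigzag ⟨pt, x₀⟩ (F := 𝟭 _)
    (G := { obj := fun x => ⟨cone x.base, D x.el⟩
            map := fun {x y} f => El.homMk (mapR f.base) (by rw [hD, f.w])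
            map_id := fun x => El.hom_ext mapR_id
            map_comp := fun f g => El.hom_ext (mapR_comp f.base g.base) })
    (𝟙 _)
    { app := fun x => El.homMk (inclR x.base) (hincl x.el)
      naturality := fun x y f => El.hom_ext (inclR_mapR f.base).symm }
    { app := fun x => El.homMk (bot x.base) (hbot x.el)
      naturality := fun x y f => El.hom_ext (bot_mapR f.base).symm }

/-- A simplicial set with an extra degeneracy has an aspherical category of elements. -/
theorem aspherical_of_extraDegeneracy' (x₀ : X.obj (op pt))
    (D : ∀ {n : SimplexCategory}, X.obj (op n) → X.obj (op (cone n)))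
    (hD : ∀ {m n : SimplexCategory} (φ : m ⟶ n) (x : X.obj (op n)),
      X.map (mapL φ).op (D x) = D (X.map φ.op x))
    (hincl : ∀ {n : SimplexCategory} (x : X.obj (op n)), X.map (inclL n).op (D x) = x)
    (htop : ∀ {n : SimplexCategory} (x : X.obj (op n)), X.map (top n).op (D x) = x₀) :
    Aspherical W (El X) :=
  hW.aspherical_of_zigzag ⟨pt, x₀⟩ (F := 𝟭 _)
    (G := { obj := fun x => ⟨cone x.base, D x.el⟩
            map := fun {x y} f => El.homMk (mapL f.base) (by rw [hD, f.w])
            map_id := fun x => El.hom_ext mapL_id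
            map_comp := fun f g => El.hom_ext (mapL_comp f.base g.base) })
    (𝟙 _)
    { app := fun x => El.homMk (inclL x.base) (hincl x.el)
      naturality := fun x y f => El.hom_ext (inclL_mapL f.base).symm }
    { app := fun x => El.homMk (top x.base) (htop x.el)
      naturality := fun x y f => El.hom_ext (top_mapL f.base).symm }

end IsBasicLocalizer

/-! ### Simplicial homotopies. -/

/-- The product of the standard simplices of dimensions `n` and `1`. -/
def prism (n : SimplexCategory) : SSet.{u} where
  obj m := ULift.{u} ((m.unop ⟶ n) × (Fin (m.unop.len + 1) →o Bool))
  map φ := ↾fun p => ⟨φ.unop ≫ p.down.1, p.down.2.comp φ.unop.toOrderHom⟩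

/-- The comparison of a prism with a slice over a simplex. -/
def prismToSlice (X : SSet.{u}) (a : El X) :
    El (prism.{u} a.base) ⥤ CostructuredArrow (El.map (cylinderProj X)) a where
  obj p := CostructuredArrow.mk (S := El.map (cylinderProj X))
    (Y := ⟨p.base, X.map p.el.down.1.op a.el, p.el.down.2⟩) (El.homMk p.el.down.1 rfl)
  map {p q} f := CostructuredArrow.homMk (El.homMk (X := cylinder X) f.base (cylinder_map_eq f.base
      ((X.map_comp_apply q.el.down.1.op f.base.op a.el).symm.trans
        (congrArg (fun e : ULift.{u} ((p.base ⟶ a.base) × (Fin (p.base.len + 1) →o Bool)) =>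
          X.map e.down.1.op a.el) f.w))
      (congrArg (fun e : ULift.{u} ((p.base ⟶ a.base) × (Fin (p.base.len + 1) →o Bool)) =>
          e.down.2) f.w)))
    (El.hom_ext (congrArg
      (fun e : ULift.{u} ((p.base ⟶ a.base) × (Fin (p.base.len + 1) →o Bool)) => e.down.1) f.w))
  map_id _ := CostructuredArrow.hom_ext _ _ (El.hom_ext rfl)
  map_comp _ _ := CostructuredArrow.hom_ext _ _ (El.hom_ext rfl)

namespace IsBasicLocalizer

variable {W : MorphismProperty Cat.{u, u}} (hW : IsBasicLocalizer W) {X Y : SSet.{u}}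
include hW

/-- The product of two standard simplices has an initial vertex, `(0, false)`, which can be put in
front of any simplex. -/
theorem aspherical_prism (n : SimplexCategory) : Aspherical W (El (prism.{u} n)) :=
  hW.aspherical_of_extraDegeneracy (X := prism.{u} n)
    ⟨SimplexCategory.Hom.mk ⟨fun _ => 0, fun _ _ _ => le_rfl⟩, ⟨fun _ => false, fun _ _ _ => le_rfl⟩⟩
    (fun p => ⟨SimplexCategory.Hom.mk (consHom 0 p.down.1.toOrderHom fun _ => Fin.zero_le _),
      consHom false p.down.2 fun _ => Bool.false_le _⟩)
    (fun φ x => ULift.ext _ _ (Prod.ext (hom_ext_cons rfl fun _ => rfl)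
      (by ext i; induction i using Fin.cases <;> rfl)))
    (fun x => ULift.ext _ _ (Prod.ext (by ext; rfl) rfl)) (fun x => rfl)

theorem mem_prismToSlice (a : El X) : Mem W (prismToSlice X a) :=
  hW.mem_of_universal _ (fun b => ⟨b.left.base, ⟨b.hom.base, b.left.el.2⟩⟩)
    (fun b => CostructuredArrow.homMk (El.homMk (X := cylinder X) (𝟙 b.left.base)
      (cylinder_map_eq (𝟙 b.left.base)
      ((X.map_id_apply _ _).trans b.hom.w.symm) rfl)) (El.hom_ext (Category.id_comp _)))
    (fun {p _} f => El.homMk (X := prism.{u} a.base) f.left.base (ULift.ext _ _ (Prod.ext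
      (congrArg El.Hom.base (CostructuredArrow.w f)) (congrArg (fun e : X.obj (op p.base) × (Fin (p.base.len + 1) →o Bool) => e.2) f.left.w))))
    (fun f => CostructuredArrow.hom_ext _ _ (El.hom_ext (Category.comp_id f.left.base)))
    (fun f g h => El.hom_ext ((Category.comp_id f.base).symm.trans
      ((congrArg (fun k => El.Hom.base (CommaMorphism.left k)) h).trans
        (Category.comp_id g.base))))

/-- The slice over an `n`-simplex is, up to `W`, the category of elements of the prism, whatever the
simplex. -/
theorem mem_cylinderProj : Mem W (El.map (cylinderProj X)) :=
  hW.mem_of_aspherical_costructuredArrow _ fun a =>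
    hW.aspherical_of_mem (hW.mem_prismToSlice a) (hW.aspherical_prism a.base)

/-- Homotopic morphisms of simplicial sets belong simultaneously to the class. -/
theorem mem_map_iff_of_homotopy {f g : X ⟶ Y} (H : cylinder X ⟶ Y)
    (hf : cylinderEnd X false ≫ H = f) (hg : cylinderEnd X true ≫ H = g) :
    Mem W (El.map f) ↔ Mem W (El.map g) := by
  -- Both ends of the cylinder are sections of its projection.
  have h (b : Bool) : Mem W (El.map (cylinderEnd X b)) :=
    hW.mem_of_comp_right (G := El.map (cylinderProj X)) hW.mem_cylinderProj hW.mem_id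
  have h' (b : Bool) : Mem W (El.map H) ↔ Mem W (El.map (cylinderEnd X b ≫ H)) :=
    ⟨fun k => hW.mem_comp (h b) k, fun k => hW.mem_of_comp_left (h b) k⟩
  rw [← hf, ← hg, ← h', ← h']

/-- A retraction of simplicial sets that is a homotopy equivalence is in the class. -/
theorem mem_map_of_deformation {i : Y ⟶ X} {r : X ⟶ Y} (h : i ≫ r = 𝟙 Y) (H : cylinder X ⟶ X)
    (h₀ : cylinderEnd X false ≫ H = 𝟙 X) (h₁ : cylinderEnd X true ≫ H = r ≫ i) :
    Mem W (El.map r) := by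
  have hid (Z : SSet.{u}) : El.map (𝟙 Z) = 𝟭 _ := rfl
  have hc : El.map i ⋙ El.map r = El.map (i ≫ r) := rfl
  refine hW.mem_retraction (I := El.map i) (by rw [hc, h, hid]) ?_
  refine (hW.mem_map_iff_of_homotopy H h₀ h₁).1 ?_
  exact hW.mem_id

end IsBasicLocalizer

/-! ### Correspondences and the projections of their total categories. -/

/-- A correspondence between simplicial sets: a bisimplicial set over their exterior product. -/
structure Correspondence (S T : SSet.{u}) where
  obj : SimplexCategory → SimplexCategory → Type u
  res {m m' n n' : SimplexCategory} (φ : m' ⟶ m) (ψ : n' ⟶ n) : obj m n → obj m' n'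
  res_id {m n : SimplexCategory} (k : obj m n) : res (𝟙 m) (𝟙 n) k = k
  res_comp {m m' m'' n n' n'' : SimplexCategory} (φ : m' ⟶ m) (φ' : m'' ⟶ m') (ψ : n' ⟶ n)
    (ψ' : n'' ⟶ n') (k : obj m n) : res (φ' ≫ φ) (ψ' ≫ ψ) k = res φ' ψ' (res φ ψ k)
  dom {m n : SimplexCategory} : obj m n → S.obj (op m)
  cod {m n : SimplexCategory} : obj m n → T.obj (op n)
  dom_res {m m' n n' : SimplexCategory} (φ : m' ⟶ m) (ψ : n' ⟶ n) (k : obj m n) :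
    dom (res φ ψ k) = S.map φ.op (dom k)
  cod_res {m m' n n' : SimplexCategory} (φ : m' ⟶ m) (ψ : n' ⟶ n) (k : obj m n) :
    cod (res φ ψ k) = T.map ψ.op (cod k)

namespace Correspondence

variable {S T : SSet.{u}} (K : Correspondence S T) {X Y : SSet.{u}}

/-- The simplicial set of elements with given domain. -/
def fiberOver {m : SimplexCategory} (s : S.obj (op m)) : SSet.{u} where
  obj n := { k : K.obj m n.unop // K.dom k = s }
  map ψ := ↾fun k => ⟨K.res (𝟙 m) ψ.unop k.1, by
    rw [K.dom_res, k.2]; exact S.map_id_apply _ _⟩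
  map_id n := by
    apply ConcreteCategory.hom_ext
    intro k
    exact Subtype.ext (K.res_id k.1)
  map_comp f g := by
    apply ConcreteCategory.hom_ext
    intro k
    refine Subtype.ext ?_
    have := K.res_comp (𝟙 m) (𝟙 m) f.unop g.unop k.1
    rw [Category.comp_id] at this
    exact this

/-- The simplicial set of elements with given codomain, over a simplicial set over `S`. -/
def slice (w : X ⟶ S) {n : SimplexCategory} (t : T.obj (op n)) : SSet.{u} where
  obj m := { p : X.obj m × K.obj m.unop n // K.dom p.2 = w.app m p.1 ∧ K.cod p.2 = t }
  map φ := ↾fun p => ⟨(X.map φ p.1.1, K.res φ.unop (𝟙 n) p.1.2), by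
    constructor
    · exact (K.dom_res _ _ _).trans ((congrArg _ p.2.1).trans (NatTrans.naturality_apply w φ _).symm)
    · exact (K.cod_res _ _ _).trans ((congrArg _ p.2.2).trans (T.map_id_apply _ _))⟩
  map_id m := by
    apply ConcreteCategory.hom_ext
    intro p
    exact Subtype.ext (Prod.ext (X.map_id_apply _ _) (K.res_id p.1.2))
  map_comp f g := by
    apply ConcreteCategory.hom_ext
    intro p
    refine Subtype.ext (Prod.ext (X.map_comp_apply _ _ _) ?_)
    have := K.res_comp f.unop g.unop (𝟙 n) (𝟙 n) p.1.2
    rw [Category.comp_id] at this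
    exact this

/-- The map of slices induced by a map over `S`. -/
def sliceMap (α : X ⟶ Y) (w : Y ⟶ S) {n : SimplexCategory} (t : T.obj (op n)) :
    K.slice (α ≫ w) t ⟶ K.slice w t where
  app m := ↾fun p => ⟨(α.app m p.1.1, p.1.2), p.2⟩
  naturality m m' φ := by
    apply ConcreteCategory.hom_ext
    intro p
    refine Subtype.ext (Prod.ext ?_ rfl)
    exact NatTrans.naturality_apply α φ p.1.1

/-- The category of elements of the bisimplicial set of pairs of a simplex of `X` and an element of
the correspondence over it. -/
structure Total (w : X ⟶ S) : Type u where
  left : SimplexCategory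
  right : SimplexCategory
  simp : X.obj (op left)
  el : K.obj left right
  h : K.dom el = w.app (op left) simp

namespace Total

variable {K} {w : X ⟶ S}

@[ext]
structure Hom (x y : K.Total w) : Type u where
  left : x.left ⟶ y.left
  right : x.right ⟶ y.right
  hsimp : X.map left.op y.simp = x.simp
  hel : K.res left right y.el = x.el

instance : Category.{u} (K.Total w) where
  Hom x y := Hom x y
  id x := ⟨𝟙 x.left, 𝟙 x.right, X.map_id_apply _ _, K.res_id _⟩
  comp f g := ⟨f.left ≫ g.left, f.right ≫ g.right,
    (X.map_comp_apply _ _ _).trans ((congrArg _ g.hsimp).trans f.hsimp),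
    (K.res_comp _ _ _ _ _).trans ((congrArg _ g.hel).trans f.hel)⟩
  id_comp f := Hom.ext (Category.id_comp f.left) (Category.id_comp f.right)
  comp_id f := Hom.ext (Category.comp_id f.left) (Category.comp_id f.right)
  assoc f g h := Hom.ext (Category.assoc f.left g.left h.left) (Category.assoc _ _ _)

/-- Constructor for morphisms, with expanded objects. -/
def homMk {m m' n n' : SimplexCategory} {s : X.obj (op m)} {s' : X.obj (op m')} {k : K.obj m n}
    {k' : K.obj m' n'} {h : K.dom k = w.app _ s} {h' : K.dom k' = w.app _ s'}
    (φ : m ⟶ m') (ψ : n ⟶ n') (hs : X.map φ.op s' = s) (hk : K.res φ ψ k' = k) :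
    (⟨m, n, s, k, h⟩ : K.Total w) ⟶ ⟨m', n', s', k', h'⟩ :=
  ⟨φ, ψ, hs, hk⟩

theorem hom_ext {x y : K.Total w} {f g : x ⟶ y} (h : f.left = g.left) (h' : f.right = g.right) :
    f = g :=
  Hom.ext h h'

theorem dom_res (x : K.Total w) {m n : SimplexCategory} {φ : m ⟶ x.left} (ψ : n ⟶ x.right)
    {s : X.obj (op m)} (hs : X.map φ.op x.simp = s) :
    K.dom (K.res φ ψ x.el) = w.app (op m) s := by
  rw [K.dom_res, x.h, ← NatTrans.naturality_apply, hs]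

variable (K w)

/-- The projection to the category of elements of the source. -/
def toDom : K.Total w ⥤ El X where
  obj x := ⟨x.left, x.simp⟩
  map f := El.homMk f.left f.hsimp

/-- The projection to the category of elements of the target of the correspondence. -/
def toCod : K.Total w ⥤ El T where
  obj x := ⟨x.right, K.cod x.el⟩
  map f := El.homMk f.right ((K.cod_res _ _ _).symm.trans (congrArg _ f.hel))

/-- The functor induced by a map over `S`. -/
def map (α : X ⟶ Y) (w : Y ⟶ S) : K.Total (α ≫ w) ⥤ K.Total w where
  obj x := ⟨x.left, x.right, α.app _ x.simp, x.el, x.h⟩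
  map f := ⟨f.left, f.right, (NatTrans.naturality_apply α _ _).symm.trans (congrArg _ f.hsimp),
    f.hel⟩

/-- The inclusion of a fibre of the first projection in a coslice. -/
def fromOver (a : El X) : El (K.fiberOver (w.app _ a.el)) ⥤ StructuredArrow a (toDom K w) where
  obj k := StructuredArrow.mk (T := toDom K w) (Y := ⟨a.base, k.base, a.el, k.el.1, k.el.2⟩)
    (El.homMk (𝟙 a.base) (X.map_id_apply _ _))
  map f := StructuredArrow.homMk
    (Total.homMk (𝟙 a.base) f.base (X.map_id_apply _ _) (congrArg Subtype.val f.w))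
    (El.hom_ext (Category.comp_id _))
  map_id _ := StructuredArrow.hom_ext _ _ (hom_ext rfl rfl)
  map_comp _ _ := StructuredArrow.hom_ext _ _ (hom_ext (Category.comp_id _).symm rfl)

/-- The inclusion of a fibre of the second projection in a coslice. -/
def fromSlice (t : El T) : El (K.slice w t.el) ⥤ StructuredArrow t (toCod K w) where
  obj k := StructuredArrow.mk (T := toCod K w)
    (Y := ⟨k.base, t.base, k.el.1.1, k.el.1.2, k.el.2.1⟩)
    (El.homMk (𝟙 t.base) ((T.map_id_apply _ _).trans k.el.2.2))
  map f := StructuredArrow.homMk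
    (Total.homMk f.base (𝟙 t.base) (congrArg (fun e => e.1.1) f.w)
      (congrArg (fun e => e.1.2) f.w))
    (El.hom_ext (Category.comp_id _))
  map_id _ := StructuredArrow.hom_ext _ _ (hom_ext rfl rfl)
  map_comp _ _ := StructuredArrow.hom_ext _ _ (hom_ext rfl (Category.comp_id _).symm)

end Total

end Correspondence

namespace IsBasicLocalizer

open Correspondence

variable {W : MorphismProperty Cat.{u, u}} (hW : IsBasicLocalizer W) {S T X Y : SSet.{u}}
  (K : Correspondence S T)
include hW

/-- Restricting an element along the structural map in the first variable is right adjoint to the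
inclusion of the fibre. So fibres compute the coslices of the projection. -/
theorem mem_fromOver (w : X ⟶ S) (a : El X) : Mem W (Total.fromOver K w a) :=
  hW.mem_of_universal _
    (fun b => ⟨b.right.right, K.res b.hom.base (𝟙 _) b.right.el, Total.dom_res _ _ b.hom.w⟩)
    (fun b => StructuredArrow.homMk (Total.homMk b.hom.base (𝟙 b.right.right) b.hom.w rfl)
      (El.hom_ext (Category.id_comp _)))
    (fun {k b} f => El.homMk (X := K.fiberOver (w.app _ a.el)) f.right.right (Subtype.ext (by
      have h₁ : f.right.left = b.hom.base :=
        (Category.id_comp _).symm.trans (congrArg El.Hom.base (StructuredArrow.w f))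
      have h₂ := K.res_comp b.hom.base (𝟙 a.base) (𝟙 _) f.right.right b.right.el
      rw [Category.id_comp, Category.comp_id] at h₂
      refine h₂.symm.trans ?_
      rw [← h₁]
      exact f.right.hel)))
    (fun {k b} f => StructuredArrow.hom_ext _ _ (Total.hom_ext
      ((Category.id_comp _).trans ((congrArg El.Hom.base (StructuredArrow.w f)).symm.trans
        (Category.id_comp _)))
      (Category.comp_id _)))
    (fun f g h => El.hom_ext ((Category.comp_id f.base).symm.trans
      ((congrArg (fun k => Total.Hom.right (StructuredArrow.Hom.right k)) h).trans (Category.comp_id g.base))))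

/-- The same adjunction as for `fromOver`, with restriction in the second variable. -/
theorem mem_fromSlice (w : X ⟶ S) (t : El T) : Mem W (Total.fromSlice K w t) :=
  hW.mem_of_universal _
    (fun b => ⟨b.right.left, ⟨(b.right.simp, K.res (𝟙 _) b.hom.base b.right.el),
      (K.dom_res _ _ _).trans ((S.map_id_apply _ _).trans b.right.h),
      (K.cod_res _ _ _).trans b.hom.w⟩⟩)
    (fun b => StructuredArrow.homMk
      (Total.homMk (𝟙 b.right.left) b.hom.base (X.map_id_apply _ _) rfl)
      (El.hom_ext (Category.id_comp _)))
    (fun {k b} f => El.homMk (X := K.slice w t.el) f.right.left (Subtype.ext (Prod.ext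
      f.right.hsimp (by
      have h₁ : f.right.right = b.hom.base :=
        (Category.id_comp _).symm.trans (congrArg El.Hom.base (StructuredArrow.w f))
      have h₂ := K.res_comp (𝟙 _) f.right.left b.hom.base (𝟙 t.base) b.right.el
      rw [Category.id_comp, Category.comp_id] at h₂
      refine h₂.symm.trans ?_
      rw [← h₁]
      exact f.right.hel))))
    (fun {k b} f => StructuredArrow.hom_ext _ _ (Total.hom_ext
      (Category.comp_id _)
      ((Category.id_comp _).trans ((congrArg El.Hom.base (StructuredArrow.w f)).symm.trans
        (Category.id_comp _)))))
    (fun f g h => El.hom_ext ((Category.comp_id f.base).symm.trans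
      ((congrArg (fun k => Total.Hom.left (StructuredArrow.Hom.right k)) h).trans (Category.comp_id g.base))))

theorem mem_toDom (w : X ⟶ S)
    (hK : ∀ {m : SimplexCategory} (s : S.obj (op m)), Aspherical W (El (K.fiberOver s))) :
    Mem W (Total.toDom K w) :=
  hW.mem_of_aspherical_structuredArrow _ fun a =>
    hW.aspherical_of_mem (hW.mem_fromOver K w a) (hK _)

/-- A map over `S` is in the class as soon as the maps it induces on slices are, if the fibres
of the correspondence over `S` are aspherical. -/
theorem mem_map_of_sliceMap (α : X ⟶ Y) (w : Y ⟶ S)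
    (hK : ∀ {m : SimplexCategory} (s : S.obj (op m)), Aspherical W (El (K.fiberOver s)))
    (h : ∀ {n : SimplexCategory} (t : T.obj (op n)), Mem W (El.map (K.sliceMap α w t))) :
    Mem W (El.map α) := by
  -- The projections to the elements of `X` and `Y` are in `W`, so `α` can be replaced by the map
  -- between total categories.
  refine (hW.mem_iff_of_square (F := Total.map K α w) (G := El.map α) (hW.mem_toDom K (α ≫ w) hK)
    (hW.mem_toDom K w hK) (𝟙 (Total.map K α w ⋙ Total.toDom K w))).1 ?_
  refine hW.mem_of_structuredArrow_pre _ (Total.toCod K w) fun t => ?_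
  -- The coslices of the other projection are replaced by the simplicial sets of elements with given
  -- codomain.
  refine (hW.mem_iff_of_square (F := El.map (K.sliceMap α w t.el))
    (G := StructuredArrow.pre t (Total.map K α w) (Total.toCod K w))
    (hW.mem_fromSlice K (α ≫ w) t) (hW.mem_fromSlice K w t)
    (𝟙 (El.map (K.sliceMap α w t.el) ⋙ Total.fromSlice K w t))).1 (h t.el)

end IsBasicLocalizer

/-! ### Lax functors on preorders, without the redundant action on 2-cells. -/

/-- A lax functor from a preorder to a bicategory. -/
structure LaxDiagram (P : Type) [Preorder P] (C : Type u) [Bicategory.{u, u} C] : Type u where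
  obj : P → C
  map {i j : P} (h : i ≤ j) : obj i ⟶ obj j
  mapId (i : P) : 𝟙 (obj i) ⟶ map (le_refl i)
  mapComp {i j k : P} (h : i ≤ j) (h' : j ≤ k) : map h ≫ map h' ⟶ map (h.trans h')
  assoc {i j k l : P} (h₁ : i ≤ j) (h₂ : j ≤ k) (h₃ : k ≤ l) :
    mapComp h₁ h₂ ▷ map h₃ ≫ mapComp (h₁.trans h₂) h₃ =
      (α_ _ _ _).hom ≫ map h₁ ◁ mapComp h₂ h₃ ≫ mapComp h₁ (h₂.trans h₃)
  id_left {i j : P} (h : i ≤ j) : mapId i ▷ map h ≫ mapComp (le_refl i) h = (λ_ (map h)).hom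
  id_right {i j : P} (h : i ≤ j) : map h ◁ mapId j ≫ mapComp h (le_refl j) = (ρ_ (map h)).hom

namespace LaxDiagram

variable {P Q R : Type} [Preorder P] [Preorder Q] [Preorder R]
variable {C : Type u} [Bicategory.{u, u} C]

theorem hext {x y : LaxDiagram P C} (h : ∀ i, x.obj i = y.obj i)
    (hmap : ∀ {i j : P} (h : i ≤ j), HEq (x.map h) (y.map h))
    (hid : ∀ i, HEq (x.mapId i) (y.mapId i))
    (hcomp : ∀ {i j k : P} (h : i ≤ j) (h' : j ≤ k), HEq (x.mapComp h h') (y.mapComp h h')) :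
    x = y := by
  obtain ⟨xo, xm, xi, xc, _, _, _⟩ := x
  obtain ⟨yo, ym, yi, yc, _, _, _⟩ := y
  obtain rfl : xo = yo := funext h
  obtain rfl : @xm = @ym := by
    funext i j h
    exact eq_of_heq (hmap h)
  obtain rfl : xi = yi := funext fun i => eq_of_heq (hid i)
  obtain rfl : @xc = @yc := by
    funext i j k h h'
    exact eq_of_heq (hcomp h h')
  rfl

/-- Restriction along a monotone map. -/
def reindex (f : P →o Q) (x : LaxDiagram Q C) : LaxDiagram P C where
  obj i := x.obj (f i)
  map h := x.map (f.monotone h)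
  mapId i := x.mapId (f i)
  mapComp h h' := x.mapComp (f.monotone h) (f.monotone h')
  assoc h₁ h₂ h₃ := x.assoc (f.monotone h₁) (f.monotone h₂) (f.monotone h₃)
  id_left h := x.id_left (f.monotone h)
  id_right h := x.id_right (f.monotone h)

/-- A lax functor is normalized if its unit 2-cells are identities. -/
def IsNormal (x : LaxDiagram P C) : Prop :=
  ∀ i, ∃ h : x.map (le_refl i) = 𝟙 (x.obj i), x.mapId i = eqToHom h.symm

theorem IsNormal.reindex {x : LaxDiagram Q C} (hx : x.IsNormal) (f : P →o Q) :
    (x.reindex f).IsNormal :=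
  fun i => hx (f i)

theorem map₂_locallyDiscrete (F : PrelaxFunctor (LocallyDiscrete P) C) {a b : LocallyDiscrete P}
    {f g : a ⟶ b} (η : f ⟶ g) (h : F.map f = F.map g) : F.map₂ η = eqToHom h := by
  obtain rfl := LocallyDiscrete.eq_of_hom η
  rw [Subsingleton.elim η (𝟙 f), F.map₂_id, eqToHom_refl]

/-- The lax functor of a lax diagram. -/
def toLax (x : LaxDiagram P C) : LaxFunctor (LocallyDiscrete P) C where
  obj i := x.obj i.as
  map f := x.map (leOfHom f.as)
  map₂ η := eqToHom (by obtain rfl := LocallyDiscrete.eq_of_hom η; rfl)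
  mapId i := x.mapId i.as
  mapComp f g := x.mapComp (leOfHom f.as) (leOfHom g.as)
  mapComp_naturality_left η g := by
    obtain rfl := LocallyDiscrete.eq_of_hom η
    simp
  mapComp_naturality_right f _ _ η := by
    obtain rfl := LocallyDiscrete.eq_of_hom η
    simp
  map₂_associator f g h := by
    have := x.assoc (leOfHom f.as) (leOfHom g.as) (leOfHom h.as)
    exact (congrArg (_ ≫ ·) (Category.comp_id _)).trans this
  map₂_leftUnitor f := by
    have := x.id_left (leOfHom f.as)
    exact ((Iso.inv_hom_id (λ_ (x.map (leOfHom f.as)))).symm.trans (congrArg (_ ≫ ·) this.symm))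
  map₂_rightUnitor f := by
    have := x.id_right (leOfHom f.as)
    exact ((Iso.inv_hom_id (ρ_ (x.map (leOfHom f.as)))).symm.trans (congrArg (_ ≫ ·) this.symm))

/-- The lax diagram of a lax functor. -/
def ofLax (F : LaxFunctor (LocallyDiscrete P) C) : LaxDiagram P C where
  obj i := F.obj ⟨i⟩
  map h := F.map ⟨homOfLE h⟩
  mapId i := F.mapId ⟨i⟩
  mapComp {i j k} h h' := F.mapComp (a := ⟨i⟩) (b := ⟨j⟩) (c := ⟨k⟩) ⟨homOfLE h⟩ ⟨homOfLE h'⟩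
  assoc {i j k l} h₁ h₂ h₃ := by
    have := F.map₂_associator (a := ⟨i⟩) (b := ⟨j⟩) (c := ⟨k⟩) (d := ⟨l⟩)
      ⟨homOfLE h₁⟩ ⟨homOfLE h₂⟩ ⟨homOfLE h₃⟩
    rw [map₂_locallyDiscrete F.toPrelaxFunctor _ rfl] at this
    exact (congrArg (_ ≫ ·) (Category.comp_id _)).symm.trans this
  id_left {i j} h := by
    have := F.map₂_leftUnitor (a := ⟨i⟩) (b := ⟨j⟩) ⟨homOfLE h⟩
    rw [map₂_locallyDiscrete F.toPrelaxFunctor _ rfl, Iso.eq_inv_comp] at this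
    exact this.symm.trans (Category.comp_id _)
  id_right {i j} h := by
    have := F.map₂_rightUnitor (a := ⟨i⟩) (b := ⟨j⟩) ⟨homOfLE h⟩
    rw [map₂_locallyDiscrete F.toPrelaxFunctor _ rfl, Iso.eq_inv_comp] at this
    exact this.symm.trans (Category.comp_id _)

theorem toLax_ofLax (F : LaxFunctor (LocallyDiscrete P) C) : (ofLax F).toLax = F := by
  refine TwoCat.ext_lax ?_ (fun _ => HEq.rfl) (fun _ _ => HEq.rfl)
  -- The only 2-cells of a locally discrete 2-category are identities, so a prelax functor on it is
  -- determined by its objects and 1-cells.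
  have (F G : PrelaxFunctor (LocallyDiscrete P) C)
      (h : G.toPrelaxFunctorStruct.toPrefunctor = F.toPrelaxFunctorStruct.toPrefunctor) :
      G = F := by
    obtain ⟨⟨F₀, F₂⟩, h₁, h₂⟩ := F
    obtain ⟨⟨G₀, G₂⟩, k₁, k₂⟩ := G
    obtain rfl : G₀ = _ := h
    congr
    ext a b f g η
    obtain rfl := LocallyDiscrete.eq_of_hom η
    rw [Subsingleton.elim η (𝟙 f)]
    exact (k₁ _).trans (h₁ _).symm
  exact this _ _ rfl

theorem isNormal_ofLax (F : StrictlyUnitaryLaxFunctor (LocallyDiscrete P) C) :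
    (ofLax F.toLaxFunctor).IsNormal :=
  fun i => ⟨F.map_id ⟨i⟩, F.mapId_eq_eqToHom ⟨i⟩⟩

/-- The normalized lax functor of a normalized lax diagram. -/
def toNormalizedLax (x : LaxDiagram P C) (hx : x.IsNormal) :
    StrictlyUnitaryLaxFunctor (LocallyDiscrete P) C where
  toLaxFunctor := x.toLax
  map_id i := (hx i.as).1
  mapId_eq_eqToHom i := (hx i.as).2

/-- Composition of a lax diagram with a strict 2-functor. -/
def mapStrict {A B : TwoCat.{u}} (v : A ⟶ B) (x : LaxDiagram P A) : LaxDiagram P B :=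
  ofLax (LaxFunctor.comp x.toLax (TwoCat.toNormalizedLax v).toLaxFunctor)

theorem IsNormal.mapStrict {A B : TwoCat.{u}} {x : LaxDiagram P A} (hx : x.IsNormal) (v : A ⟶ B) :
    (x.mapStrict v).IsNormal :=
  isNormal_ofLax (StrictlyUnitaryLaxFunctor.comp (x.toNormalizedLax hx) (TwoCat.toNormalizedLax v))

theorem mapStrict_comp {A B C : TwoCat.{u}} (v : A ⟶ B) (w : B ⟶ C) (x : LaxDiagram P A) :
    x.mapStrict (v ≫ w) = (x.mapStrict v).mapStrict w := by
  refine hext (fun _ => rfl) (fun _ => HEq.rfl) (fun i => heq_of_eq ?_) (fun h h' => heq_of_eq ?_)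
  · exact TwoCat.map₂_comp_aux (TwoCat.toNormalizedLax w).toPrelaxFunctor
      ((TwoCat.toNormalizedLax w).mapId _) ((TwoCat.toNormalizedLax v).mapId (x.obj i))
      ((TwoCat.toNormalizedLax v).map₂ (x.mapId i))
  · exact TwoCat.map₂_comp_aux (TwoCat.toNormalizedLax w).toPrelaxFunctor
      ((TwoCat.toNormalizedLax w).mapComp _ _)
      ((TwoCat.toNormalizedLax v).mapComp (x.map h) (x.map h'))
      ((TwoCat.toNormalizedLax v).map₂ (x.mapComp h h'))

/-- The simplicial set of lax diagrams. -/
def sset (C : Type u) [Bicategory.{u, u} C] : SSet.{u} where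
  obj n := LaxDiagram (Fin (n.unop.len + 1)) C
  map φ := ↾fun x => x.reindex φ.unop.toOrderHom

/-- The simplicial set of normalized lax diagrams. -/
def nset (C : Type u) [Bicategory.{u, u} C] : SSet.{u} where
  obj n := { x : LaxDiagram (Fin (n.unop.len + 1)) C // x.IsNormal }
  map φ := ↾fun x => ⟨x.1.reindex φ.unop.toOrderHom, x.2.reindex _⟩

/-- The inclusion of normalized lax diagrams. -/
def incl (C : Type u) [Bicategory.{u, u} C] : nset C ⟶ sset C where
  app n := ↾fun x => x.1

/-- The action of strict 2-functors on lax diagrams. -/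
def ssetMap {A B : TwoCat.{u}} (v : A ⟶ B) : sset A ⟶ sset B where
  app n := ↾fun x => x.mapStrict v

/-- The action of strict 2-functors on normalized lax diagrams. -/
def nsetMap {A B : TwoCat.{u}} (v : A ⟶ B) : nset A ⟶ nset B where
  app n := ↾fun x => ⟨x.1.mapStrict v, x.2.mapStrict v⟩

/-- The lax nerve consists of lax diagrams. -/
def nerveIso (A : TwoCat.{u}) : TwoCat.laxNerve.obj A ≅ sset A where
  hom := { app n := ↾fun x => ofLax x }
  inv := { app n := ↾fun x => x.toLax }
  hom_inv_id := by
    ext n x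
    exact toLax_ofLax x
  inv_hom_id := by
    ext n x
    rfl

/-- The normalized lax nerve consists of normalized lax diagrams. -/
def normalizedNerveIso (A : TwoCat.{u}) : TwoCat.normalizedLaxNerve.obj A ≅ nset A where
  hom := { app n := ↾fun x => ⟨ofLax x.toLaxFunctor, isNormal_ofLax x⟩ }
  inv := { app n := ↾fun x => x.1.toNormalizedLax x.2 }
  hom_inv_id := by
    ext n x
    exact TwoCat.normalized_ext (toLax_ofLax x.toLaxFunctor)
  inv_hom_id := by
    ext n x
    rfl

theorem nerveIso_naturality {A B : TwoCat.{u}} (v : A ⟶ B) :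
    TwoCat.laxNerve.map v ≫ (nerveIso B).hom = (nerveIso A).hom ≫ ssetMap v := by
  ext n x
  rfl

theorem normalizedNerveIso_naturality {A B : TwoCat.{u}} (v : A ⟶ B) :
    TwoCat.normalizedLaxNerve.map v ≫ (normalizedNerveIso B).hom =
      (normalizedNerveIso A).hom ≫ nsetMap v := by
  ext n x
  rfl

end LaxDiagram

/-! ### Lax cones, their mixtures and their joins. -/

section

variable {P P' Q Q' : Type} [Preorder P] [Preorder P'] [Preorder Q] [Preorder Q']
variable {C : Type u} [Bicategory.{u, u} C]

/-- A lax cone from a lax diagram to another: an extension to the join of their shapes. -/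
structure LaxCone (x : LaxDiagram P C) (z : LaxDiagram Q C) : Type u where
  leg (i : P) (k : Q) : x.obj i ⟶ z.obj k
  lam {i j : P} (h : i ≤ j) (k : Q) : x.map h ≫ leg j k ⟶ leg i k
  rho (i : P) {k l : Q} (h : k ≤ l) : leg i k ≫ z.map h ⟶ leg i l
  lam_id (i : P) (k : Q) : x.mapId i ▷ leg i k ≫ lam (le_refl i) k = (λ_ (leg i k)).hom
  lam_comp {i j l : P} (h : i ≤ j) (h' : j ≤ l) (k : Q) :
    x.mapComp h h' ▷ leg l k ≫ lam (h.trans h') k =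
      (α_ _ _ _).hom ≫ x.map h ◁ lam h' k ≫ lam h k
  rho_id (i : P) (k : Q) : leg i k ◁ z.mapId k ≫ rho i (le_refl k) = (ρ_ (leg i k)).hom
  rho_comp (i : P) {k l m : Q} (h : k ≤ l) (h' : l ≤ m) :
    leg i k ◁ z.mapComp h h' ≫ rho i (h.trans h') =
      (α_ _ _ _).inv ≫ rho i h ▷ z.map h' ≫ rho i h'
  lam_rho {i j : P} {k l : Q} (h : i ≤ j) (h' : k ≤ l) :
    lam h k ▷ z.map h' ≫ rho i h' = (α_ _ _ _).hom ≫ x.map h ◁ rho j h' ≫ lam h l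

/-- A lax cone from a lax diagram to an object. -/
structure ConeTo (x : LaxDiagram P C) (c : C) : Type u where
  leg (i : P) : x.obj i ⟶ c
  lam {i j : P} (h : i ≤ j) : x.map h ≫ leg j ⟶ leg i
  lam_id (i : P) : x.mapId i ▷ leg i ≫ lam (le_refl i) = (λ_ (leg i)).hom
  lam_comp {i j l : P} (h : i ≤ j) (h' : j ≤ l) :
    x.mapComp h h' ▷ leg l ≫ lam (h.trans h') = (α_ _ _ _).hom ≫ x.map h ◁ lam h' ≫ lam h

namespace ConeTo

/-- Restriction along a monotone map. -/
def reindex {x : LaxDiagram P C} {c : C} (q : ConeTo x c) (f : P' →o P) :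
    ConeTo (x.reindex f) c where
  leg i := q.leg (f i)
  lam h := q.lam (f.monotone h)
  lam_id i := q.lam_id (f i)
  lam_comp h h' := q.lam_comp (f.monotone h) (f.monotone h')

/-- Composition of a cone to the initial vertex of a diagram with the edges of the diagram. -/
def extend [OrderBot Q] {x : LaxDiagram P C} {z : LaxDiagram Q C} (q : ConeTo x (z.obj ⊥)) :
    LaxCone x z where
  leg i k := q.leg i ≫ z.map bot_le
  lam h k := (α_ _ _ _).inv ≫ q.lam h ▷ z.map bot_le
  rho i _ _ h := (α_ _ _ _).hom ≫ q.leg i ◁ z.mapComp bot_le h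
  lam_id i k := by
    have := q.lam_id i
    simp [← comp_whiskerRight, this]
  lam_comp h h' k := by
    have := congrArg (· ▷ z.map (bot_le : ⊥ ≤ k)) (q.lam_comp h h')
    simp only [comp_whiskerRight] at this
    simp [this]
  rho_id i k := by
    have := z.id_right (bot_le : ⊥ ≤ k)
    simp [← whiskerLeft_comp, this]
  rho_comp i {k _ _} h h' := by
    have := congrArg (q.leg i ◁ ·) (z.assoc (bot_le : ⊥ ≤ k) h h')
    simp only [whiskerLeft_comp] at this
    simp [this]
  lam_rho {_ _ k l} h h' := by
    have := whisker_exchange (q.lam h) (z.mapComp (bot_le : ⊥ ≤ k) h')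
    simp only [whiskerRight_comp, comp_whiskerLeft, Category.assoc] at this
    rw [Iso.eq_inv_comp] at this
    simp [← this]

end ConeTo

namespace LaxCone

variable {x : LaxDiagram P C} {z : LaxDiagram Q C}

/-- Restriction along monotone maps. -/
def reindex (k : LaxCone x z) (f : P' →o P) (g : Q' →o Q) :
    LaxCone (x.reindex f) (z.reindex g) where
  leg i j := k.leg (f i) (g j)
  lam h j := k.lam (f.monotone h) (g j)
  rho i _ _ h := k.rho (f i) (g.monotone h)
  lam_id i j := k.lam_id (f i) (g j)
  lam_comp h h' j := k.lam_comp (f.monotone h) (f.monotone h') (g j)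
  rho_id i j := k.rho_id (f i) (g j)
  rho_comp i _ _ _ h h' := k.rho_comp (f i) (g.monotone h) (g.monotone h')
  lam_rho h h' := k.lam_rho (f.monotone h) (g.monotone h')

/-- Restriction to a vertex of the target. -/
def toConeTo (k : LaxCone x z) (j : Q) : ConeTo x (z.obj j) where
  leg i := k.leg i j
  lam h := k.lam h j
  lam_id i := k.lam_id i j
  lam_comp h h' := k.lam_comp h h' j

/-- The leg of the mixture of a cone with the cone induced by its restriction to the initial
vertex. -/
def mixLeg [OrderBot Q] (k : LaxCone x z) (b : Bool) (i : P) (j : Q) : x.obj i ⟶ z.obj j :=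
  match b with
  | false => k.leg i j
  | true => k.leg i ⊥ ≫ z.map bot_le

/-- The action of the source on the mixture of two cones. -/
def mixLam [OrderBot Q] (k : LaxCone x z) (b b' : Bool) (hb : b ≤ b') {i i' : P} (h : i ≤ i')
    (j : Q) : x.map h ≫ k.mixLeg b' i' j ⟶ k.mixLeg b i j :=
  match b, b', hb with
  | false, false, _ => k.lam h j
  -- The cell `rho` goes from the leg through the initial vertex to the original leg. This direction
  -- dictates that the original cone sits at `false` and the induced one at `true`.
  | false, true, _ => x.map h ◁ k.rho i' bot_le ≫ k.lam h j
  | true, true, _ => (k.toConeTo ⊥).extend.lam h j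

/-- The action of the target on the mixture of two cones. -/
def mixRho [OrderBot Q] (k : LaxCone x z) (b : Bool) (i : P) {j j' : Q} (h : j ≤ j') :
    k.mixLeg b i j ≫ z.map h ⟶ k.mixLeg b i j' :=
  match b with
  | false => k.rho i h
  | true => (k.toConeTo ⊥).extend.rho i h

theorem mixLam_id [OrderBot Q] (k : LaxCone x z) (i : P) (j : Q) : (b : Bool) →
    x.mapId i ▷ k.mixLeg b i j ≫ k.mixLam b b (le_refl b) (le_refl i) j = (λ_ _).hom
  | false => k.lam_id i j
  | true => (k.toConeTo ⊥).extend.lam_id i j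

theorem mixRho_id [OrderBot Q] (k : LaxCone x z) (i : P) (j : Q) : (b : Bool) →
    k.mixLeg b i j ◁ z.mapId j ≫ k.mixRho b i (le_refl j) = (ρ_ _).hom
  | false => k.rho_id i j
  | true => (k.toConeTo ⊥).extend.rho_id i j

theorem mixRho_comp [OrderBot Q] (k : LaxCone x z) (i : P) {j₁ j₂ j₃ : Q} (h : j₁ ≤ j₂)
    (h' : j₂ ≤ j₃) : (b : Bool) →
    k.mixLeg b i j₁ ◁ z.mapComp h h' ≫ k.mixRho b i (h.trans h') =
      (α_ _ _ _).inv ≫ k.mixRho b i h ▷ z.map h' ≫ k.mixRho b i h'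
  | false => k.rho_comp i h h'
  | true => (k.toConeTo ⊥).extend.rho_comp i h h'

/-- When the jump from `false` to `true` is at the second step, interchange moves `rho` past the
composition cell of `x`; when it is at the first step, the compatibility `lam_rho` is what moves
`rho` before `lam`. -/
theorem mixLam_comp [OrderBot Q] (k : LaxCone x z) {i₁ i₂ i₃ : P} (h : i₁ ≤ i₂) (h' : i₂ ≤ i₃)
    (j : Q) : (b₁ b₂ b₃ : Bool) → (h₁ : b₁ ≤ b₂) → (h₂ : b₂ ≤ b₃) →
    x.mapComp h h' ▷ k.mixLeg b₃ i₃ j ≫ k.mixLam b₁ b₃ (h₁.trans h₂) (h.trans h') j =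
      (α_ _ _ _).hom ≫ x.map h ◁ k.mixLam b₂ b₃ h₂ h' j ≫ k.mixLam b₁ b₂ h₁ h j
  | false, false, false, _, _ => k.lam_comp h h' j
  | false, false, true, _, _ => by
    have := k.lam_comp h h' j
    simp only [mixLam, mixLeg]
    rw [← whisker_exchange_assoc, this]
    simp
  | false, true, true, _, _ => by
    have h₁ := k.lam_comp h h' j
    have h₂ := k.lam_rho h' (bot_le : ⊥ ≤ j)
    change x.mapComp h h' ▷ (k.leg i₃ ⊥ ≫ z.map bot_le) ≫ _ ◁ k.rho i₃ bot_le ≫ k.lam _ j =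
      (α_ _ _ _).hom ≫ x.map h ◁ ((α_ _ _ _).inv ≫ k.lam h' ⊥ ▷ z.map bot_le) ≫
        x.map h ◁ k.rho i₂ bot_le ≫ k.lam h j
    rw [← whisker_exchange_assoc, h₁, ← whiskerLeft_comp_assoc, Category.assoc, h₂]
    simp
  | true, true, true, _, _ => (k.toConeTo ⊥).extend.lam_comp h h' j

theorem mixLam_mixRho [OrderBot Q] (k : LaxCone x z) {i i' : P} {j j' : Q} (h : i ≤ i')
    (h' : j ≤ j') : (b b' : Bool) → (hb : b ≤ b') →
    k.mixLam b b' hb h j ▷ z.map h' ≫ k.mixRho b i h' =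
      (α_ _ _ _).hom ≫ x.map h ◁ k.mixRho b' i' h' ≫ k.mixLam b b' hb h j'
  | false, false, _ => k.lam_rho h h'
  | false, true, _ => by
    have h₁ := k.lam_rho h h'
    have h₂ := k.rho_comp i' (bot_le : ⊥ ≤ j) h'
    rw [Iso.eq_inv_comp] at h₂
    change (x.map h ◁ k.rho i' bot_le ≫ k.lam h j) ▷ z.map h' ≫ k.rho i h' =
      (α_ _ _ _).hom ≫ x.map h ◁ ((α_ _ _ _).hom ≫ k.leg i' ⊥ ◁ z.mapComp bot_le h') ≫
        x.map h ◁ k.rho i' bot_le ≫ k.lam h j'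
    rw [comp_whiskerRight, Category.assoc, h₁, ← whiskerLeft_comp_assoc, Category.assoc, h₂]
    simp
  | true, true, _ => (k.toConeTo ⊥).extend.lam_rho h h'

/-- The mixture of a cone with the cone induced by its restriction to the initial vertex. -/
def mix [OrderBot Q] (k : LaxCone x z) (t : P →o Bool) : LaxCone x z where
  leg i j := k.mixLeg (t i) i j
  lam {i i'} h j := k.mixLam (t i) (t i') (t.monotone h) h j
  rho i _ _ h := k.mixRho (t i) i h
  lam_id i j := k.mixLam_id i j (t i)
  lam_comp h h' j := k.mixLam_comp h h' j _ _ _ (t.monotone h) (t.monotone h')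
  rho_id i j := k.mixRho_id i j (t i)
  rho_comp i _ _ _ h h' := k.mixRho_comp i h h' (t i)
  lam_rho h h' := k.mixLam_mixRho h h' _ _ (t.monotone h)

end LaxCone

/-- The join of two preorders. -/
inductive Join (P Q : Type) : Type
  | inl (p : P)
  | inr (q : Q)

namespace Join

/-- The order relation of the join. -/
def Le : Join P Q → Join P Q → Prop
  | inl p, inl p' => p ≤ p'
  | inl _, inr _ => True
  | inr _, inl _ => False
  | inr q, inr q' => q ≤ q'

instance : Preorder (Join P Q) where
  le := Le
  le_refl a := by cases a <;> exact le_refl _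
  le_trans a b c h h' := by
    cases a <;> cases b <;> cases c <;> first | trivial | exact h.elim | exact h'.elim | exact le_trans h h'

/-- The join of two monotone maps. -/
def map (f : P →o P') (g : Q →o Q') : Join P Q →o Join P' Q' where
  toFun
    | inl p => inl (f p)
    | inr q => inr (g q)
  monotone' := by
    rintro (a | a) (b | b) h
    · exact f.monotone h
    · trivial
    · exact h.elim
    · exact g.monotone h

/-- The inclusion of the first factor. -/
def inlHom : P →o Join P Q := ⟨inl, fun _ _ h => h⟩

/-- The inclusion of the second factor. -/
def inrHom : Q →o Join P Q := ⟨inr, fun _ _ h => h⟩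

end Join

namespace LaxCone

open Join

variable {x : LaxDiagram P C} {z : LaxDiagram Q C}

/-- The vertices of the join. -/
def joinObj (x : LaxDiagram P C) (z : LaxDiagram Q C) : Join P Q → C
  | inl i => x.obj i
  | inr k => z.obj k

/-- The edges of the join. -/
def joinMap (k : LaxCone x z) : (a b : Join P Q) → a ≤ b → (joinObj x z a ⟶ joinObj x z b)
  | inl _, inl _, h => x.map h
  | inl i, inr j, _ => k.leg i j
  | inr _, inr _, h => z.map h

/-- The units of the join. -/
def joinId (k : LaxCone x z) : (a : Join P Q) → (𝟙 (joinObj x z a) ⟶ k.joinMap a a (le_refl a))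
  | inl i => x.mapId i
  | inr j => z.mapId j

/-- The composition cells of the join. -/
def joinComp (k : LaxCone x z) : (a b c : Join P Q) → (h : a ≤ b) → (h' : b ≤ c) →
    (k.joinMap a b h ≫ k.joinMap b c h' ⟶ k.joinMap a c (h.trans h'))
  | inl _, inl _, inl _, h, h' => x.mapComp h h'
  | inl _, inl _, inr j, h, _ => k.lam h j
  | inl i, inr _, inr _, _, h' => k.rho i h'
  | inr _, inr _, inr _, h, h' => z.mapComp h h'

/-- The lax diagram on the join of two preorders given by a lax cone. -/
def join (k : LaxCone x z) : LaxDiagram (Join P Q) C where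
  obj := joinObj x z
  map h := k.joinMap _ _ h
  mapId := k.joinId
  mapComp h h' := k.joinComp _ _ _ h h'
  assoc {a b c d} h₁ h₂ h₃ :=
    match a, b, c, d, h₁, h₂, h₃ with
    | inl _, inl _, inl _, inl _, h₁, h₂, h₃ => x.assoc h₁ h₂ h₃
    | inl _, inl _, inl _, inr j, h₁, h₂, _ => k.lam_comp h₁ h₂ j
    | inl _, inl _, inr _, inr _, h₁, _, h₃ => k.lam_rho h₁ h₃
    | inl i, inr _, inr _, inr _, _, h₂, h₃ => by
      have := k.rho_comp i h₂ h₃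
      rw [Iso.eq_inv_comp] at this
      exact this.symm
    | inr _, inr _, inr _, inr _, h₁, h₂, h₃ => z.assoc h₁ h₂ h₃
  id_left {a b} h :=
    match a, b, h with
    | inl _, inl _, h => x.id_left h
    | inl i, inr j, _ => k.lam_id i j
    | inr _, inr _, h => z.id_left h
  id_right {a b} h :=
    match a, b, h with
    | inl _, inl _, h => x.id_right h
    | inl i, inr j, _ => k.rho_id i j
    | inr _, inr _, h => z.id_right h

theorem join_isNormal (k : LaxCone x z) (hx : x.IsNormal) (hz : z.IsNormal) : k.join.IsNormal
  | inl i => hx i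
  | inr j => hz j

end LaxCone

/-- The constant normalized diagram on a point. -/
def LaxDiagram.point (c : C) : LaxDiagram PUnit C where
  obj _ := c
  map _ := 𝟙 c
  mapId _ := 𝟙 _
  mapComp _ _ := (λ_ (𝟙 c)).hom
  assoc _ _ _ := by simp [unitors_equal]
  id_left _ := by simp
  id_right _ := by simp [unitors_equal]

theorem LaxDiagram.point_isNormal (c : C) : (LaxDiagram.point c).IsNormal := fun _ => ⟨rfl, rfl⟩

namespace LaxCone

open Join

variable {x : LaxDiagram P C} {z : LaxDiagram Q C}

/-- This and the next five identities are the cone axioms in the cases where an edge of the constant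
diagram on a point contributes an identity. -/
theorem unit_whisker {a b : C} (f : a ⟶ b) : 𝟙 (𝟙 a) ▷ f ≫ (λ_ f).hom = (λ_ f).hom := by simp

theorem unit_comp_whisker {a b : C} (f : a ⟶ b) :
    (λ_ (𝟙 a)).hom ▷ f ≫ (λ_ f).hom = (α_ _ _ _).hom ≫ 𝟙 a ◁ (λ_ f).hom ≫ (λ_ f).hom := by
  rw [unitors_equal, triangle_assoc]

theorem leftUnitor_naturality_aux {a b c : C} {f : a ⟶ b} {g : b ⟶ c} {k : a ⟶ c}
    (r : f ≫ g ⟶ k) : (λ_ f).hom ▷ g ≫ r = (α_ _ _ _).hom ≫ 𝟙 a ◁ r ≫ (λ_ k).hom := by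
  simp

theorem whisker_unit {a b : C} (f : a ⟶ b) : f ◁ 𝟙 (𝟙 b) ≫ (ρ_ f).hom = (ρ_ f).hom := by simp

theorem whisker_unit_comp {a b : C} (f : a ⟶ b) :
    f ◁ (λ_ (𝟙 b)).hom ≫ (ρ_ f).hom = (α_ _ _ _).inv ≫ (ρ_ f).hom ▷ 𝟙 b ≫ (ρ_ f).hom := by
  simp [unitors_equal]

theorem triangle_aux {a b c : C} {f : a ⟶ b} {g : b ⟶ c} {k : a ⟶ c} (r : f ≫ g ⟶ k) :
    f ◁ (λ_ g).hom ≫ r = (α_ _ _ _).inv ≫ (ρ_ f).hom ▷ g ≫ r := by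
  simp

theorem rightUnitor_naturality_aux {a b c : C} {f : a ⟶ b} {g : b ⟶ c} {k : a ⟶ c}
    (r : f ≫ g ⟶ k) : r ▷ 𝟙 c ≫ (ρ_ k).hom = (α_ _ _ _).hom ≫ f ◁ (ρ_ g).hom ≫ r := by
  simp

/-- Restriction of a cone to a vertex of the source, the unit of which is normalized. -/
def fromPoint (k : LaxCone x z) (i : P) : LaxCone (LaxDiagram.point (x.obj i)) z where
  leg _ j := k.leg i j
  -- The cell is the unitor and not `k.lam (le_refl i) j`: `x` need not be normalized at `i`,
  -- whereas the inserted vertex will belong to the target of a cone, which must be.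
  lam _ _ := (λ_ _).hom
  rho _ _ _ h := k.rho i h
  lam_id _ j := unit_whisker (k.leg i j)
  lam_comp _ _ j := unit_comp_whisker (k.leg i j)
  rho_id _ j := k.rho_id i j
  rho_comp _ _ _ _ h h' := k.rho_comp i h h'
  lam_rho _ _ := leftUnitor_naturality_aux _

variable [OrderTop P]

/-- The legs of the extension of a cone to the last vertex of its source. -/
def insertLeg (k : LaxCone x z) (i : P) :
    (a : Join PUnit Q) → (x.obj i ⟶ (k.fromPoint ⊤).join.obj a)
  | inl _ => x.map le_top
  | inr j => k.leg i j

/-- The action of the source on the extension of a cone to the last vertex of its source. -/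
def insertLam (k : LaxCone x z) {i i' : P} (h : i ≤ i') :
    (a : Join PUnit Q) → (x.map h ≫ k.insertLeg i' a ⟶ k.insertLeg i a)
  | inl _ => x.mapComp h le_top
  | inr j => k.lam h j

/-- The action of the target on the extension of a cone to the last vertex of its source. -/
def insertRho (k : LaxCone x z) (i : P) : (a b : Join PUnit Q) → (h : a ≤ b) →
    (k.insertLeg i a ≫ (k.fromPoint ⊤).join.map h ⟶ k.insertLeg i b)
  | inl _, inl _, _ => (ρ_ _).hom
  -- The edge from the inserted vertex to `j` is the leg of `k` at `⊤`; following `x.map le_top` by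
  -- it maps to the leg at `i` by the action of the source.
  | inl _, inr j, _ => k.lam le_top j
  | inr _, inr _, h => k.rho i h

/-- The extension of a cone to the last vertex of its source. -/
def insert (k : LaxCone x z) : LaxCone x (k.fromPoint ⊤).join where
  leg := k.insertLeg
  lam h a := k.insertLam h a
  rho i _ _ h := k.insertRho i _ _ h
  lam_id i
    | inl _ => x.id_left le_top
    | inr j => k.lam_id i j
  lam_comp h h'
    | inl _ => x.assoc h h' le_top
    | inr j => k.lam_comp h h' j
  rho_id i
    | inl _ => whisker_unit _
    | inr j => k.rho_id i j
  rho_comp i {a b c} h h' :=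
    match a, b, c, h, h' with
    | inl _, inl _, inl _, _, _ => whisker_unit_comp _
    | inl _, inl _, inr _, _, _ => triangle_aux _
    | inl _, inr _, inr _, _, h => (Iso.eq_inv_comp _).2 (k.lam_rho (le_top : i ≤ ⊤) h).symm
    | inr _, inr _, inr _, h, h' => k.rho_comp i h h'
  lam_rho {_ _ a b} h h' :=
    match a, b, h' with
    | inl _, inl _, _ => rightUnitor_naturality_aux _
    | inl _, inr j, _ => k.lam_comp h le_top j
    | inr _, inr _, h' => k.lam_rho h h'

end LaxCone

end

/-! ### Cones with varying source and target. -/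

/-- A lax cone with arbitrary source and normalized target. -/
structure LaxJoin (P Q : Type) [Preorder P] [Preorder Q] (C : Type u) [Bicategory.{u, u} C] :
    Type u where
  dom : LaxDiagram P C
  cod : LaxDiagram Q C
  cone : LaxCone dom cod
  normal : cod.IsNormal

/-- A cone to a fixed object with arbitrary source. -/
structure ConeJoin (P : Type) [Preorder P] {C : Type u} [Bicategory.{u, u} C] (c : C) :
    Type u where
  dom : LaxDiagram P C
  cone : ConeTo dom c

section

variable {P P' Q Q' : Type} [Preorder P] [Preorder P'] [Preorder Q] [Preorder Q']
variable {C : Type u} [Bicategory.{u, u} C]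

namespace ConeTo

theorem ext_of_eqToHom {x : LaxDiagram P C} {c : C} {q q' : ConeTo x c}
    (h : ∀ i, q.leg i = q'.leg i)
    (hlam : ∀ {i j : P} (hij : i ≤ j),
      q.lam hij ≫ eqToHom (h i) = x.map hij ◁ eqToHom (h j) ≫ q'.lam hij) : q = q' := by
  obtain ⟨l, m, _, _⟩ := q
  obtain ⟨l', m', _, _⟩ := q'
  obtain rfl : l = l' := funext h
  obtain rfl : @m = @m' := by
    funext i j hij
    simpa using hlam hij
  rfl

theorem eqToHom_comp_id [Strict C] {a b : C} {g : a ⟶ b} (h : g ≫ 𝟙 b = g) :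
    eqToHom h = (ρ_ g).hom := by
  rw [Strict.rightUnitor_eqToIso]
  rfl

theorem whisker_eqToHom [Strict C] {a b c : C} {f : a ⟶ b} {g : b ⟶ c} {k : a ⟶ c}
    (r : f ≫ g ⟶ k) {e : c ⟶ c} (he : e = 𝟙 c) (h₁ : k ≫ e = k) (h₂ : g ≫ e = g) :
    ((α_ f g e).inv ≫ r ▷ e) ≫ eqToHom h₁ = f ◁ eqToHom h₂ ≫ r := by
  subst he
  rw [eqToHom_comp_id, eqToHom_comp_id]
  simp

theorem comp_of_eq_id [Strict C] {a b : C} (g : a ⟶ b) {e : b ⟶ b} (he : e = 𝟙 b) :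
    g ≫ e = g := by
  rw [he, Strict.comp_id]

/-- Normality of `z` is needed here: extending and restricting composes each leg with `z.map` of `⊥
≤ ⊥`, which must be an identity. -/
theorem toConeTo_extend [Strict C] [OrderBot Q] {x : LaxDiagram P C} {z : LaxDiagram Q C}
    (hz : z.IsNormal) (q : ConeTo x (z.obj ⊥)) : q.extend.toConeTo ⊥ = q :=
  ext_of_eqToHom (fun i => comp_of_eq_id (q.leg i) (hz ⊥).1)
    (fun hij => whisker_eqToHom (q.lam hij) (hz ⊥).1 _ _)

end ConeTo

namespace LaxJoin

theorem hext {k k' : LaxJoin P Q C} (hd : k.dom = k'.dom) (hc : k.cod = k'.cod)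
    (hleg : ∀ i j, HEq (k.cone.leg i j) (k'.cone.leg i j))
    (hlam : ∀ {i i' : P} (h : i ≤ i') (j), HEq (k.cone.lam h j) (k'.cone.lam h j))
    (hrho : ∀ (i) {j j' : Q} (h : j ≤ j'), HEq (k.cone.rho i h) (k'.cone.rho i h)) : k = k' := by
  obtain ⟨d, c, ⟨l, a, r, _, _, _, _, _⟩, _⟩ := k
  obtain ⟨d', c', ⟨l', a', r', _, _, _, _, _⟩, _⟩ := k'
  obtain rfl : d = d' := hd
  obtain rfl : c = c' := hc
  obtain rfl : l = l' := by
    funext i j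
    exact eq_of_heq (hleg i j)
  obtain rfl : @a = @a' := by
    funext i i' h j
    exact eq_of_heq (hlam h j)
  obtain rfl : @r = @r' := by
    funext i j j' h
    exact eq_of_heq (hrho i h)
  rfl

/-- Restriction along monotone maps. -/
def reindex (k : LaxJoin P Q C) (f : P' →o P) (g : Q' →o Q) : LaxJoin P' Q' C where
  dom := k.dom.reindex f
  cod := k.cod.reindex g
  cone := k.cone.reindex f g
  normal := k.normal.reindex g

/-- Extension to the last vertex of the source. -/
def insert [OrderTop P] (k : LaxJoin P Q C) : LaxJoin P (Join PUnit Q) C where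
  dom := k.dom
  cod := (k.cone.fromPoint ⊤).join
  cone := k.cone.insert
  normal := (k.cone.fromPoint ⊤).join_isNormal (LaxDiagram.point_isNormal _) k.normal

theorem insert_reindex [OrderTop P] (k : LaxJoin P Q C) (g : Q' →o Q) :
    k.insert.reindex OrderHom.id (Join.map OrderHom.id g) =
      (k.reindex OrderHom.id g).insert := by
  refine hext rfl (LaxDiagram.hext ?_ ?_ ?_ ?_) ?_ ?_ ?_
  · rintro (_ | _) <;> rfl
  · rintro (_ | _) (_ | _) h <;> first | rfl | exact h.elim
  · rintro (_ | _) <;> rfl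
  · rintro (_ | _) (_ | _) (_ | _) h h' <;> first | rfl | exact h.elim | exact h'.elim
  · rintro i (_ | _) <;> rfl
  · rintro i i' h (_ | _) <;> rfl
  · rintro i (_ | _) (_ | _) h <;> first | rfl | exact h.elim

/-- The mixture of a cone with the cone induced by its restriction to the initial vertex. -/
def mix [OrderBot Q] (k : LaxJoin P Q C) (t : P →o Bool) : LaxJoin P Q C where
  dom := k.dom
  cod := k.cod
  cone := k.cone.mix t
  normal := k.normal

/-- Restriction to the initial vertex of a given target. -/
def toConeJoin [OrderBot Q] (z : LaxDiagram Q C) :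
    (k : LaxJoin P Q C) → k.cod = z → ConeJoin P (z.obj ⊥)
  | ⟨d, _, q, _⟩, rfl => ⟨d, q.toConeTo ⊥⟩

theorem toConeJoin_dom [OrderBot Q] (z : LaxDiagram Q C) :
    (k : LaxJoin P Q C) → (h : k.cod = z) → (k.toConeJoin z h).dom = k.dom
  | ⟨_, _, _, _⟩, rfl => rfl

end LaxJoin

namespace ConeJoin

/-- Restriction along a monotone map. -/
def reindex {c : C} (q : ConeJoin P c) (f : P' →o P) : ConeJoin P' c where
  dom := q.dom.reindex f
  cone := q.cone.reindex f

/-- Composition with the edges of a normalized diagram. -/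
def extend [OrderBot Q] {z : LaxDiagram Q C} (q : ConeJoin P (z.obj ⊥)) (hz : z.IsNormal) :
    LaxJoin P Q C where
  dom := q.dom
  cod := z
  cone := q.cone.extend
  normal := hz

theorem toConeJoin_extend [Strict C] [OrderBot Q] {z : LaxDiagram Q C}
    (q : ConeJoin P (z.obj ⊥)) (hz : z.IsNormal) : (q.extend hz).toConeJoin z rfl = q :=
  congrArg (ConeJoin.mk q.dom) (ConeTo.toConeTo_extend hz q.cone)

end ConeJoin

/-- The cone from a lax diagram to its last vertex. -/
def LaxDiagram.apex [OrderTop P] (s : LaxDiagram P C) :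
    LaxCone s (LaxDiagram.point (s.obj ⊤)) where
  leg _ _ := s.map le_top
  lam h _ := s.mapComp h le_top
  rho _ _ _ _ := (ρ_ _).hom
  lam_id _ _ := s.id_left le_top
  lam_comp h h' _ := s.assoc h h' le_top
  rho_id _ _ := LaxCone.whisker_unit _
  rho_comp _ _ _ _ _ _ := LaxCone.whisker_unit_comp _
  lam_rho _ _ := LaxCone.rightUnitor_naturality_aux _

end

/-! ### The correspondence of lax cones and Theorem A for cones. -/

section

variable (C : Type u) [Bicategory.{u, u} C] {X Y : SSet.{u}}

/-- The correspondence given by lax cones. -/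
def laxCones : Correspondence (LaxDiagram.sset C) (LaxDiagram.nset C) where
  obj m n := LaxJoin (Fin (m.len + 1)) (Fin (n.len + 1)) C
  res φ ψ k := k.reindex φ.toOrderHom ψ.toOrderHom
  res_id _ := rfl
  res_comp _ _ _ _ _ := rfl
  dom k := k.dom
  cod k := ⟨k.cod, k.normal⟩
  dom_res _ _ _ := rfl
  cod_res _ _ _ := rfl

/-- The identification of `[0] * [n]` with a join. -/
def consJoin (n : SimplexCategory) : Fin (n.len + 1 + 1) →o Join PUnit (Fin (n.len + 1)) :=
  consHom (Join.inl PUnit.unit) Join.inrHom fun _ => trivial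

theorem consJoin_mapR {m n : SimplexCategory} (φ : m ⟶ n) :
    (consJoin n).comp (mapR φ).toOrderHom =
      (Join.map OrderHom.id φ.toOrderHom).comp (consJoin m) := by
  ext i
  induction i using Fin.cases <;> rfl

theorem insert_reindex_consJoin {P : Type} [Preorder P] [OrderTop P] {m n : SimplexCategory}
    (φ : m ⟶ n) (k : LaxJoin P (Fin (n.len + 1)) C) :
    (k.insert.reindex OrderHom.id (consJoin n)).reindex OrderHom.id (mapR φ).toOrderHom =
      (k.reindex OrderHom.id φ.toOrderHom).insert.reindex OrderHom.id (consJoin m) := by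
  change k.insert.reindex OrderHom.id ((consJoin n).comp (mapR φ).toOrderHom) = _
  rw [consJoin_mapR, ← LaxJoin.insert_reindex]
  rfl

/-- The last vertex of `s` is inserted as a new first vertex of the target. What remains on that
vertex alone is the cone `s.apex`, which depends on `s` only and serves as base point. -/
theorem IsBasicLocalizer.aspherical_laxCones_fiberOver {W : MorphismProperty Cat.{u, u}}
    (hW : IsBasicLocalizer W) {m : SimplexCategory} (s : (LaxDiagram.sset C).obj (op m)) :
    Aspherical W (El ((laxCones C).fiberOver s)) :=
  hW.aspherical_of_extraDegeneracy (X := (laxCones C).fiberOver s)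
    ⟨⟨s, (LaxDiagram.point _).reindex ⟨fun _ => PUnit.unit, fun _ _ _ => le_rfl⟩,
      s.apex.reindex OrderHom.id ⟨fun _ => PUnit.unit, fun _ _ _ => le_rfl⟩,
      (LaxDiagram.point_isNormal _).reindex _⟩, rfl⟩
    (fun {n} k => ⟨k.1.insert.reindex OrderHom.id (consJoin n), k.2⟩)
    (fun φ k => Subtype.ext (insert_reindex_consJoin C φ k.1))
    (fun k => rfl)
    (fun k => by
      obtain ⟨k, rfl⟩ := k
      rfl)

end

section

variable {C : Type u} [Bicategory.{u, u} C] {X Y : SSet.{u}}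

/-- The simplicial set of cones to an object, over a simplicial set of lax diagrams. -/
def coneOver (w : X ⟶ LaxDiagram.sset C) (c : C) : SSet.{u} where
  obj n := { p : X.obj n × ConeJoin (Fin (n.unop.len + 1)) c // p.2.dom = w.app n p.1 }
  map φ := ↾fun p => ⟨(X.map φ p.1.1, p.1.2.reindex φ.unop.toOrderHom),
    (congrArg (LaxDiagram.reindex φ.unop.toOrderHom) p.2).trans
      (NatTrans.naturality_apply w φ _).symm⟩
  map_id n := by
    apply ConcreteCategory.hom_ext
    intro p
    exact Subtype.ext (Prod.ext (X.map_id_apply _ _) rfl)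
  map_comp f g := by
    apply ConcreteCategory.hom_ext
    intro p
    exact Subtype.ext (Prod.ext (X.map_comp_apply _ _ _) rfl)

/-- The map of simplicial sets of cones induced by a map over lax diagrams. -/
def coneOverMap (α : X ⟶ Y) (w : Y ⟶ LaxDiagram.sset C) (c : C) :
    coneOver (α ≫ w) c ⟶ coneOver w c where
  app n := ↾fun p => ⟨(α.app n p.1.1, p.1.2), p.2⟩
  naturality m n φ := by
    apply ConcreteCategory.hom_ext
    intro p
    refine Subtype.ext (Prod.ext ?_ rfl)
    exact NatTrans.naturality_apply α φ p.1.1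

variable (w : X ⟶ LaxDiagram.sset C) {n : SimplexCategory} (z : (LaxDiagram.nset C).obj (op n))

/-- Restriction of cones to the initial vertex of a normalized simplex. -/
noncomputable def sliceRestrict : (laxCones C).slice w z ⟶ coneOver w (z.1.obj ⊥) where
  app m := ↾fun p => ⟨(p.1.1, p.1.2.toConeJoin z.1 (congrArg Subtype.val p.2.2)),
    (LaxJoin.toConeJoin_dom _ _ _).trans p.2.1⟩
  naturality m m' φ := by
    apply ConcreteCategory.hom_ext
    rintro ⟨⟨x, k⟩, h, h'⟩
    subst h'
    rfl

/-- Extension of cones from the initial vertex of a normalized simplex. -/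
noncomputable def sliceExtend : coneOver w (z.1.obj ⊥) ⟶ (laxCones C).slice w z where
  app m := ↾fun p => ⟨(p.1.1, p.1.2.extend z.2), p.2, rfl⟩

/-- The homotopy contracting a slice over a simplex to the slice over its initial vertex. -/
noncomputable def sliceHomotopy : cylinder ((laxCones C).slice w z) ⟶ (laxCones C).slice w z where
  app m := ↾fun p => ⟨(p.1.1.1, p.1.1.2.mix p.2), p.1.2⟩

/-- Restriction to the initial vertex has `sliceExtend` as a section, and the mixtures of cones form
a homotopy from the identity to the other composite. -/
theorem IsBasicLocalizer.mem_sliceRestrict [Strict C] {W : MorphismProperty Cat.{u, u}}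
    (hW : IsBasicLocalizer W) : Mem W (El.map (sliceRestrict w z)) := by
  refine hW.mem_map_of_deformation (i := sliceExtend w z) ?_ (sliceHomotopy w z) rfl ?_
  · ext m p
    exact Subtype.ext (Prod.ext rfl (ConeJoin.toConeJoin_extend p.1.2 z.2))
  · apply NatTrans.ext
    funext m
    apply ConcreteCategory.hom_ext
    rintro ⟨⟨x, k⟩, h, h'⟩
    -- `toConeJoin` is defined by matching on this equation and computes only once it is
    -- reflexivity.
    subst h'
    rfl

/-- A map over lax diagrams is in the class as soon as the maps it induces between simplicial sets
of cones are. -/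
theorem IsBasicLocalizer.mem_map_of_coneOverMap [Strict C] {W : MorphismProperty Cat.{u, u}}
    (hW : IsBasicLocalizer W) (α : X ⟶ Y) (w : Y ⟶ LaxDiagram.sset C)
    (h : ∀ c : C, Mem W (El.map (coneOverMap α w c))) : Mem W (El.map α) :=
  hW.mem_map_of_sliceMap (laxCones C) α w (hW.aspherical_laxCones_fiberOver C) fun z =>
    -- Restriction to the initial vertex turns cones to a simplex into cones to an object.
    (hW.mem_iff_of_square (F := El.map ((laxCones C).sliceMap α w z))
      (G := El.map (coneOverMap α w (z.1.obj ⊥)))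
      (hW.mem_sliceRestrict (α ≫ w) z) (hW.mem_sliceRestrict w z)
      (𝟙 (El.map ((laxCones C).sliceMap α w z) ⋙ El.map (sliceRestrict w z)))).2 (h _)

end

theorem IsBasicLocalizer.mem_map_iso {W : MorphismProperty Cat.{u, u}} (hW : IsBasicLocalizer W)
    {X Y : SSet.{u}} (e : X ≅ Y) : Mem W (El.map e.hom) := by
  have hid (Z : SSet.{u}) : El.map (𝟙 Z) = 𝟭 _ := rfl
  have h₁ : El.map e.inv ⋙ El.map e.hom = 𝟭 _ :=
    (congrArg El.map e.inv_hom_id).trans (hid Y)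
  have h₂ : El.map e.hom ⋙ El.map e.inv = 𝟭 _ :=
    (congrArg El.map e.hom_inv_id).trans (hid X)
  exact hW.mem_retraction h₁ (h₂ ▸ hW.mem_id)

theorem IsBasicLocalizer.mem_map_iff_of_iso {W : MorphismProperty Cat.{u, u}}
    (hW : IsBasicLocalizer W) {X Y X' Y' : SSet.{u}} {α : X ⟶ Y} {β : X' ⟶ Y'} (e : X ≅ X')
    (e' : Y ≅ Y') (h : α ≫ e'.hom = e.hom ≫ β) : Mem W (El.map α) ↔ Mem W (El.map β) :=
  hW.mem_iff_of_square (hW.mem_map_iso e) (hW.mem_map_iso e')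
    (eqToHom (congrArg El.map h : El.map (α ≫ e'.hom) = El.map (e.hom ≫ β)))

/-! ### Simplices of a colax slice as simplices with a cone. -/

section

variable {C : Type u} [Bicategory.{u, u} C]

/-- This converts the condition on a 2-cell of the slice, where the coherence cell of the 2-functor
appears directly, into the cone axiom for the composite diagram, where its inverse appears. -/
theorem whisker_inv_comp_iff {a b c : C} {f g k : a ⟶ b} {h : b ⟶ c} {t : a ⟶ c} (e : f ≅ g)
    (m : f ⟶ k) (l : k ≫ h ⟶ t) (r : g ≫ h ⟶ t) :
    (e.inv ≫ m) ▷ h ≫ l = r ↔ m ▷ h ≫ l = e.hom ▷ h ≫ r := by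
  rw [comp_whiskerRight, Category.assoc]
  exact ((Iso.eq_inv_comp (whiskerRightIso e h)).trans eq_comm).symm.trans eq_comm |>.symm

/-- A cone with source a given diagram. -/
def ConeJoin.coneOfEq {P : Type} [Preorder P] {c : C} (d : LaxDiagram P C) :
    (q : ConeJoin P c) → q.dom = d → ConeTo d c
  | ⟨_, q⟩, rfl => q

theorem ConeJoin.hext {P : Type} [Preorder P] {c : C} {q q' : ConeJoin P c} (hd : q.dom = q'.dom)
    (hleg : ∀ i, HEq (q.cone.leg i) (q'.cone.leg i))
    (hlam : ∀ {i j : P} (h : i ≤ j), HEq (q.cone.lam h) (q'.cone.lam h)) : q = q' := by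
  obtain ⟨d, ⟨l, a, _, _⟩⟩ := q
  obtain ⟨d', ⟨l', a', _, _⟩⟩ := q'
  obtain rfl : d = d' := hd
  obtain rfl : l = l' := funext fun i => eq_of_heq (hleg i)
  obtain rfl : @a = @a' := by
    funext i j h
    exact eq_of_heq (hlam h)
  rfl

/-- Cones over equal maps. -/
def coneOverCongr {X : SSet.{u}} {w w' : X ⟶ LaxDiagram.sset C} (h : w = w') (c : C) :
    coneOver w c ≅ coneOver w' c where
  hom :=
    { app n := ↾fun p => ⟨p.1, p.2.trans (congrArg (fun v : X ⟶ _ => v.app n p.1.1) h)⟩ }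
  inv :=
    { app n := ↾fun p => ⟨p.1, p.2.trans (congrArg (fun v : X ⟶ _ => v.app n p.1.1) h.symm)⟩ }

end

section

variable {P P' : Type} [Preorder P] [Preorder P'] {A C : TwoCat.{u}} (w : A ⟶ C) (c : C)

namespace LaxDiagram

/-- The lax diagram underlying a lax diagram in a colax slice. -/
def sliceBase (x : LaxDiagram P (TwoCat.colaxSlice w c)) : LaxDiagram P A where
  obj i := (x.obj i).base
  map h := (x.map h).base
  mapId i := (x.mapId i).base
  mapComp h h' := (x.mapComp h h').base
  assoc h₁ h₂ h₃ := congrArg ColaxSlice.Hom₂.base (x.assoc h₁ h₂ h₃)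
  id_left h := congrArg ColaxSlice.Hom₂.base (x.id_left h)
  id_right h := congrArg ColaxSlice.Hom₂.base (x.id_right h)

/-- The cone given by a lax diagram in a colax slice. -/
def sliceCone (x : LaxDiagram P (TwoCat.colaxSlice w c)) :
    ConeTo ((x.sliceBase w c).mapStrict w) c where
  leg i := (x.obj i).hom
  lam h := (x.map h).cell
  lam_id i := (whisker_inv_comp_iff (w.mapId _) _ _ _).2 (x.mapId i).w
  lam_comp h h' := (whisker_inv_comp_iff (w.mapComp _ _) _ _ _).2 (x.mapComp h h').w

/-- The lax diagram in a colax slice given by a cone. -/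
def ofSlice (x : LaxDiagram P A) (q : ConeTo (x.mapStrict w) c) :
    LaxDiagram P (TwoCat.colaxSlice w c) where
  obj i := ⟨x.obj i, q.leg i⟩
  map h := ⟨x.map h, q.lam h⟩
  mapId i := ⟨x.mapId i, (whisker_inv_comp_iff (w.mapId _) _ _ _).1 (q.lam_id i)⟩
  mapComp h h' := ⟨x.mapComp h h', (whisker_inv_comp_iff (w.mapComp _ _) _ _ _).1 (q.lam_comp h h')⟩
  assoc h₁ h₂ h₃ := ColaxSlice.hom₂_ext (x.assoc h₁ h₂ h₃)
  id_left h := ColaxSlice.hom₂_ext (x.id_left h)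
  id_right h := ColaxSlice.hom₂_ext (x.id_right h)

theorem IsNormal.sliceBase {x : LaxDiagram P (TwoCat.colaxSlice w c)} (hx : x.IsNormal) :
    (x.sliceBase w c).IsNormal := fun i => by
  obtain ⟨h, h'⟩ := hx i
  exact ⟨congrArg ColaxSlice.Hom.base h,
    (congrArg ColaxSlice.Hom₂.base h').trans (ColaxSlice.eqToHom_base h.symm)⟩

theorem IsNormal.ofSlice {x : LaxDiagram P A} (hx : x.IsNormal) (q : ConeTo (x.mapStrict w) c) :
    (ofSlice w c x q).IsNormal := fun i => by
  obtain ⟨h, h'⟩ := hx i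
  -- The base of the unit 2-cell is an identity, so the condition defining 2-cells of the slice
  -- forces the cell of the 1-cell to be that of the identity.
  have h₁ : (LaxDiagram.ofSlice w c x q).map (le_refl i) = 𝟙 _ := Eq.symm <|
    ColaxSlice.hom_ext h.symm ((congrArg (fun e => w.map₂ e ▷ _ ≫ _) h'.symm).trans
      ((LaxDiagram.ofSlice w c x q).mapId i).w)
  exact ⟨h₁, ColaxSlice.hom₂_ext (h'.trans (ColaxSlice.eqToHom_base h₁.symm).symm)⟩

/-- Lax diagrams in a colax slice are cones. -/
def sliceIso : sset (TwoCat.colaxSlice w c) ≅ coneOver (ssetMap w) c where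
  hom := { app n := ↾fun x => ⟨(x.sliceBase w c, ⟨_, x.sliceCone w c⟩), rfl⟩ }
  inv :=
    { app n := ↾fun p => ofSlice w c p.1.1 (p.1.2.coneOfEq (p.1.1.mapStrict w) p.2)
      naturality m n φ := by
        apply ConcreteCategory.hom_ext
        rintro ⟨⟨x, ⟨d, q⟩⟩, h⟩
        obtain rfl : d = LaxDiagram.mapStrict w x := h
        rfl }
  hom_inv_id := by
    apply NatTrans.ext
    funext n
    apply ConcreteCategory.hom_ext
    intro x
    rfl
  inv_hom_id := by
    apply NatTrans.ext
    funext n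
    apply ConcreteCategory.hom_ext
    rintro ⟨⟨x, ⟨d, q⟩⟩, h⟩
    obtain rfl : d = LaxDiagram.mapStrict w x := h
    rfl

/-- Normalized lax diagrams in a colax slice are cones. -/
def normalizedSliceIso : nset (TwoCat.colaxSlice w c) ≅ coneOver (incl A ≫ ssetMap w) c where
  hom := { app n := ↾fun x => ⟨(⟨x.1.sliceBase w c, x.2.sliceBase⟩, ⟨_, x.1.sliceCone w c⟩), rfl⟩ }
  inv :=
    { app n := ↾fun p => ⟨ofSlice w c p.1.1.1 (p.1.2.coneOfEq (p.1.1.1.mapStrict w) p.2), p.1.1.2.ofSlice w c _⟩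
      naturality m n φ := by
        apply ConcreteCategory.hom_ext
        rintro ⟨⟨x, ⟨d, q⟩⟩, h⟩
        obtain rfl : d = LaxDiagram.mapStrict w x.1 := h
        rfl }
  hom_inv_id := by
    apply NatTrans.ext
    funext n
    apply ConcreteCategory.hom_ext
    intro x
    rfl
  inv_hom_id := by
    apply NatTrans.ext
    funext n
    apply ConcreteCategory.hom_ext
    rintro ⟨⟨x, ⟨d, q⟩⟩, h⟩
    obtain rfl : d = LaxDiagram.mapStrict w x.1 := h
    rfl

end LaxDiagram

end

namespace LaxDiagram

section

variable {P : Type} [Preorder P] {A B C : TwoCat.{u}} (v : A ⟶ B) (w : B ⟶ C) (c : C)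

/-- The coherence cells of the induced 2-functor on slices are transports along equalities, and so
are those of the strict 2-functor `v` beneath it. -/
theorem mapStrict_sliceBase (x : LaxDiagram P (TwoCat.colaxSlice (v ≫ w) c)) :
    (x.mapStrict (TwoCat.colaxSliceMap v w c)).sliceBase w c =
      (x.sliceBase (v ≫ w) c).mapStrict v := by
  refine hext (fun _ => rfl) (fun _ => HEq.rfl) (fun i => heq_of_eq ?_) (fun h h' => heq_of_eq ?_)
  · exact congrArg (· ≫ v.map₂ (x.mapId i).base) ((ColaxSlice.eqToHom_base
      ((TwoCat.colaxSliceMap v w c).map_id (x.obj i)).symm).trans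
      (congrArg Iso.inv (v.mapId_eq_eqToIso (x.obj i).base)).symm)
  · exact congrArg (· ≫ v.map₂ (x.mapComp h h').base) ((ColaxSlice.eqToHom_base
      ((TwoCat.colaxSliceMap v w c).map_comp (x.map h) (x.map h')).symm).trans
      (congrArg Iso.inv (v.mapComp_eq_eqToIso (x.map h).base (x.map h').base)).symm)

/-- The cones are compared as elements of `ConeJoin` because their source diagrams are equal without
being definitionally so. -/
theorem mapStrict_sliceCone (x : LaxDiagram P (TwoCat.colaxSlice (v ≫ w) c)) :
    (⟨_, (x.mapStrict (TwoCat.colaxSliceMap v w c)).sliceCone w c⟩ : ConeJoin P c) =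
      ⟨_, x.sliceCone (v ≫ w) c⟩ :=
  ConeJoin.hext ((congrArg (mapStrict w) (mapStrict_sliceBase v w c x)).trans
    (mapStrict_comp v w _).symm) (fun _ => HEq.rfl) (fun _ => HEq.rfl)

theorem ssetMap_comp : ssetMap (v ≫ w) = ssetMap v ≫ ssetMap w := by
  ext n x
  exact mapStrict_comp v w x

theorem ssetMap_sliceIso :
    ssetMap (TwoCat.colaxSliceMap v w c) ≫ (sliceIso w c).hom =
      (sliceIso (v ≫ w) c ≪≫ coneOverCongr (ssetMap_comp v w) c).hom ≫
        coneOverMap (ssetMap v) (ssetMap w) c := by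
  apply NatTrans.ext
  funext n
  apply ConcreteCategory.hom_ext
  intro x
  exact Subtype.ext (Prod.ext (mapStrict_sliceBase v w c x) (mapStrict_sliceCone v w c x))

/-- Normalized nerves are regarded as lying over the full lax nerve of `C`, so that the result on
cones with arbitrary source applies to them. -/
theorem incl_ssetMap_comp : incl A ≫ ssetMap (v ≫ w) = nsetMap v ≫ incl B ≫ ssetMap w := by
  ext n x
  exact mapStrict_comp v w x.1

theorem nsetMap_normalizedSliceIso :
    nsetMap (TwoCat.colaxSliceMap v w c) ≫ (normalizedSliceIso w c).hom =
      (normalizedSliceIso (v ≫ w) c ≪≫ coneOverCongr (incl_ssetMap_comp v w) c).hom ≫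
        coneOverMap (nsetMap v) (incl B ≫ ssetMap w) c := by
  apply NatTrans.ext
  funext n
  apply ConcreteCategory.hom_ext
  intro x
  exact Subtype.ext (Prod.ext (Subtype.ext (mapStrict_sliceBase v w c x.1))
    (mapStrict_sliceCone v w c x.1))

end

end LaxDiagram

open LaxDiagram

section

variable {W : MorphismProperty Cat.{u, u}} {A B C : TwoCat.{u}}

theorem IsBasicLocalizer.laxClass_iff (hW : IsBasicLocalizer W) (v : A ⟶ B) :
    TwoCat.laxClass W v ↔ Mem W (El.map (ssetMap v)) :=
  (hW.simplices_map_iff (TwoCat.laxNerve.map v)).trans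
    (hW.mem_map_iff_of_iso (nerveIso A) (nerveIso B) (nerveIso_naturality v))

theorem IsBasicLocalizer.normalizedLaxClass_iff (hW : IsBasicLocalizer W) (v : A ⟶ B) :
    TwoCat.normalizedLaxClass W v ↔ Mem W (El.map (nsetMap v)) :=
  (hW.simplices_map_iff (TwoCat.normalizedLaxNerve.map v)).trans
    (hW.mem_map_iff_of_iso (normalizedNerveIso A) (normalizedNerveIso B)
      (normalizedNerveIso_naturality v))

theorem IsBasicLocalizer.laxClass_of_slice (hW : IsBasicLocalizer W) (v : A ⟶ B) (w : B ⟶ C)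
    (h : ∀ c : C, TwoCat.laxClass W (TwoCat.colaxSliceMap v w c)) : TwoCat.laxClass W v :=
  (hW.laxClass_iff v).2 <| hW.mem_map_of_coneOverMap (ssetMap v) (ssetMap w) fun c =>
    (hW.mem_map_iff_of_iso _ _ (ssetMap_sliceIso v w c)).1 ((hW.laxClass_iff _).1 (h c))

theorem IsBasicLocalizer.normalizedLaxClass_of_slice (hW : IsBasicLocalizer W) (v : A ⟶ B)
    (w : B ⟶ C) (h : ∀ c : C, TwoCat.normalizedLaxClass W (TwoCat.colaxSliceMap v w c)) :
    TwoCat.normalizedLaxClass W v :=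
  (hW.normalizedLaxClass_iff v).2 <|
    hW.mem_map_of_coneOverMap (nsetMap v) (incl B ≫ ssetMap w) fun c =>
      (hW.mem_map_iff_of_iso _ _ (nsetMap_normalizedSliceIso v w c)).1
        ((hW.normalizedLaxClass_iff _).1 (h c))

end

/-! ### Objects admitting a terminal object, and axiom (LF2). -/

section

variable {P P' : Type} [Preorder P] [Preorder P'] {A : TwoCat.{u}} {z : A}
variable (hz : TwoCat.AdmitsTerminal z)

/-- The terminal 1-cell to an object admitting a terminal object. -/
noncomputable def TwoCat.AdmitsTerminal.to (a : A) : a ⟶ z :=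
  @Limits.terminal (a ⟶ z) _ (hz a)

/-- The terminal 2-cell. -/
noncomputable def TwoCat.AdmitsTerminal.from {a : A} (f : a ⟶ z) : f ⟶ hz.to a :=
  @Limits.terminal.from (a ⟶ z) _ (hz a) f

include hz in
theorem TwoCat.AdmitsTerminal.hom_ext {a : A} {f : a ⟶ z} (β γ : f ⟶ hz.to a) : β = γ :=
  @Limits.terminal.hom_ext (a ⟶ z) _ (hz a) _ β γ

/-- The cone of terminal 1-cells. -/
noncomputable def LaxDiagram.terminalCone (x : LaxDiagram P A) :
    LaxCone x (LaxDiagram.point z) where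
  leg i _ := hz.to (x.obj i)
  lam _ _ := hz.from _
  rho _ _ _ _ := hz.from _
  lam_id _ _ := hz.hom_ext _ _
  lam_comp _ _ _ := hz.hom_ext _ _
  rho_id _ _ := hz.hom_ext _ _
  rho_comp _ _ _ _ _ _ := hz.hom_ext _ _
  lam_rho _ _ := hz.hom_ext _ _

theorem LaxDiagram.terminalCone_join_reindex (x : LaxDiagram P A) (f : P' →o P) :
    (x.terminalCone hz).join.reindex (Join.map f OrderHom.id) =
      ((x.reindex f).terminalCone hz).join := by
  refine LaxDiagram.hext ?_ ?_ ?_ ?_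
  · rintro (_ | _) <;> rfl
  · rintro (_ | _) (_ | _) h <;> first | rfl | exact h.elim
  · rintro (_ | _) <;> rfl
  · rintro (_ | _) (_ | _) (_ | _) h h' <;> first | rfl | exact h.elim | exact h'.elim

/-- The identification of `[n] * [0]` with a join. -/
def joinSnoc (n : SimplexCategory) : Fin (n.len + 1 + 1) →o Join (Fin (n.len + 1)) PUnit :=
  snocHom Join.inlHom (Join.inr PUnit.unit) fun _ => trivial

theorem joinSnoc_last (n : SimplexCategory) :
    joinSnoc n (Fin.last _) = Join.inr PUnit.unit := snocHom_last _ _ fun _ => trivial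

theorem joinSnoc_castSucc {n : SimplexCategory} (i : Fin (n.len + 1)) :
    joinSnoc n i.castSucc = Join.inl i := snocHom_castSucc _ _ (fun _ => trivial) i

theorem joinSnoc_mapL {m n : SimplexCategory} (φ : m ⟶ n) :
    (joinSnoc n).comp (mapL φ).toOrderHom =
      (Join.map φ.toOrderHom OrderHom.id).comp (joinSnoc m) := by
  ext i
  induction i using Fin.lastCases with
  | last =>
    exact (congrArg (joinSnoc n) (mapL_last φ)).trans ((joinSnoc_last n).trans
      (congrArg (Join.map φ.toOrderHom OrderHom.id) (joinSnoc_last m)).symm)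
  | cast i =>
    exact (congrArg (joinSnoc n) (mapL_castSucc φ i)).trans ((joinSnoc_castSucc _).trans
      (congrArg (Join.map φ.toOrderHom OrderHom.id) (joinSnoc_castSucc i)).symm)

theorem joinSnoc_inclL (n : SimplexCategory) :
    (joinSnoc n).comp (inclL n).toOrderHom = Join.inlHom := by
  ext i
  exact joinSnoc_castSucc i

theorem joinSnoc_top (n : SimplexCategory) :
    (joinSnoc n).comp (top n).toOrderHom =
      Join.inrHom.comp ⟨fun _ => PUnit.unit, fun _ _ _ => le_rfl⟩ := by
  ext i
  exact joinSnoc_last n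

include hz in
-- Appending `z` to a simplex is an extra degeneracy on the right. All cone axioms hold by
-- uniqueness of 2-cells to a terminal 1-cell, and the point at `z` keeps the simplex normalized.
theorem IsBasicLocalizer.aspherical_nset {W : MorphismProperty Cat.{u, u}}
    (hW : IsBasicLocalizer W) : Aspherical W (El (nset A)) :=
  hW.aspherical_of_extraDegeneracy' (X := nset A)
    ⟨(point z).reindex ⟨fun _ => PUnit.unit, fun _ _ _ => le_rfl⟩, (point_isNormal z).reindex _⟩
    (fun {n} x => ⟨(x.1.terminalCone hz).join.reindex (joinSnoc n),
      ((x.1.terminalCone hz).join_isNormal x.2 (point_isNormal z)).reindex _⟩)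
    (fun {m _} φ x => Subtype.ext
      ((congrArg (fun f => (x.1.terminalCone hz).join.reindex f) (joinSnoc_mapL φ)).trans
        (congrArg (reindex (joinSnoc m)) (x.1.terminalCone_join_reindex hz φ.toOrderHom))))
    (fun {n} x => Subtype.ext
      (congrArg (fun f => (x.1.terminalCone hz).join.reindex f) (joinSnoc_inclL n)))
    (fun {n} x => Subtype.ext
      (congrArg (fun f => (x.1.terminalCone hz).join.reindex f) (joinSnoc_top n)))

theorem hasTerminal_hom_punit (a b : LocallyDiscrete (Discrete PUnit.{u + 1})) :
    Limits.HasTerminal (a ⟶ b) := by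
  have hu (f : a ⟶ b) : f = ⟨eqToHom (Subsingleton.elim _ _)⟩ := by
    obtain ⟨f⟩ := f
    exact congrArg Discrete.mk (Subsingleton.elim _ _)
  exact Limits.IsTerminal.hasTerminal (X := (⟨eqToHom (Subsingleton.elim _ _)⟩ : a ⟶ b))
    (Limits.IsTerminal.ofUniqueHom (fun f => eqToHom (hu f)) fun _ _ => Subsingleton.elim _ _)

theorem admitsTerminal_point : TwoCat.AdmitsTerminal (A := TwoCat.point.{u}) ⟨⟨PUnit.unit⟩⟩ :=
  fun a => hasTerminal_hom_punit a _

theorem IsBasicLocalizer.normalizedLaxClass_toPoint {W : MorphismProperty Cat.{u, u}}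
    (hW : IsBasicLocalizer W) (A : TwoCat.{u}) (h : ∃ z : A, TwoCat.AdmitsTerminal z) :
    TwoCat.normalizedLaxClass W (TwoCat.toPoint A) := by
  obtain ⟨z, hz⟩ := h
  -- The terminal 2-category also has an object admitting a terminal object, so both nerves are
  -- aspherical and any map between them is in the class.
  exact (hW.normalizedLaxClass_iff _).2 (hW.mem_of_aspherical (hW.aspherical_nset hz)
    (hW.aspherical_nset admitsTerminal_point) _)

end

theorem IsWeaklySaturated.inverseImage {C D : Type*} [Category C] [Category D]
    {W : MorphismProperty D} (hW : IsWeaklySaturated W) (F : C ⥤ D) :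
    IsWeaklySaturated (W.inverseImage F) where
  id_mem X := by
    change W (F.map (𝟙 X))
    rw [F.map_id]
    exact hW.id_mem _
  comp_mem f g hf hg := by
    change W (F.map (f ≫ g))
    rw [F.map_comp]
    exact hW.comp_mem _ _ hf hg
  of_comp_left f g hf hfg := hW.of_comp_left _ _ hf (F.map_comp f g ▸ hfg)
  of_comp_right f g hg hfg := hW.of_comp_right _ _ hg (F.map_comp f g ▸ hfg)
  retraction_mem i r h hri := hW.retraction_mem _ _ (by rw [← F.map_comp, h, F.map_id])
    ((congrArg (fun f => W f) (F.map_comp r i)).mp hri)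

end TwoCatLoc

theorem mainTheorem8 (W : MorphismProperty Cat.{u, u}) (hW : TwoCatLoc.IsBasicLocalizer W) :
    (∀ {A B C : TwoCatLoc.TwoCat.{u}} (u : A ⟶ B) (v : B ⟶ C),
      (∀ c : C, TwoCatLoc.TwoCat.laxClass W (TwoCatLoc.TwoCat.colaxSliceMap u v c)) →
        TwoCatLoc.TwoCat.laxClass W u) ∧
    TwoCatLoc.TwoCat.IsBasicLocalizer (TwoCatLoc.TwoCat.normalizedLaxClass W) :=
  ⟨fun u v h => hW.laxClass_of_slice u v h,
    { weaklySaturated := hW.weaklySaturated.inverseImage _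
      terminal_mem := hW.normalizedLaxClass_toPoint
      slice_mem := hW.normalizedLaxClass_of_slice }⟩
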